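/- Let $\mathbb G=(\mathbb R^N,\circ)$ be a stratified Lie group: a Lie group structure on $\mathbb R^N=\mathbb R^{N_1}\times\dots\times\mathbb R^{N_r}$ for which every dilation $\delta_\lambda(x',x^{(2)},\dots,x^{(r)})=(\lambda x',\lambda^2x^{(2)},\dots,\lambda^r x^{(r)})$, $\lambda>0$, is an automorphism and for which the left-invariant vector fields $X_1,\dots,X_{N_1}$ with $X_j(0)=\partial_{x_j'}|_0$ span, together with their iterated commutators, $\mathbb R^N$ at every point. Put $\nabla_H=(X_1,\dots,X_{N_1})$ and $\mathcal L_pf=\nabla_H\cdot(|\nabla_Hf|^{p-2}\nabla_Hf)$. Let $\Omega\subset\mathbb G$ be a nonempty bounded open set, let $\alpha>0$, $\gamma<0$, $p>1$, $s>0$, and consider $$u_t-\mathcal L_pu=\alpha|u|^{q-1}u+\gamma|u|^{s-1}u\ \text{ in }\Omega,\ t>0,\qquad u=0\ \text{ on }\partial\Omega,\ t>0,\qquad u(0,\cdot)=u_0\ \text{ in }\Omega. \tag{P}$$ Here $S^{1,m}_0(\Omega)$ is the completion of $C_0^\infty(\Omega)$ in the norm of $f\mapsto(f,\nabla_Hf)\in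 L^m(\Omega)$ (supremum norm for $m=\infty$). An admissible initial datum is a $u_0\in S^{1,\infty}_0(\Omega)$ (taken as its continuous representative) with $u_0\ge0$, $u_0\not\equiv0$. Put $Q_T=(0,T)\times\Omega$, $0<T<\infty$, and $m=\max\{p,q,s\}$. A nonnegative function $u\in C([0,T)\times\overline\Omega)\cap L^m((0,T);S^{1,m}_0(\Omega))$ with $\partial_tu\in L^2((0,T);L^2(\Omega))$ is a weak sub-solution (super-solution) of (P) on $Q_T$ if $u(0,\cdot)\le u_0$ ($\ge u_0$) in $\Omega$, $u\le0$ ($\ge 0$) on $(0,T)\times\partial\Omega$, and $$\iint_{Q_T}\partial_tu\,\phi+|\nabla_Hu|^{p-2}\nabla_Hu\cdot\nabla_H\phi\,dx\,dt\ \le\ (\ge)\ \iint_{Q_T}\bigl(\alpha|u|^{q-1}u+\gamma|u|^{s-1}u\bigr)\phi\,dx\,dt$$ for all $\phi\in C(\overline{Q_T})\cap L^p((0,T);S_0^{1,p}(\Omega))$ with $\phi\ge0$ and $\phi=0$ on $(0,T)\times\partial\Omega$; a weak solution is both. Let $T_{\max}(u_0)$ be the supremum of all $T$ for which a weak solution on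 $Q_T$ exists ($0$ if there is none). We say that the solution with initial datum $u_0$ blows up in finite time if there are $0<T_1<\infty$ and a function $\mu$ with $\mu(t)\to\infty$ as $t\uparrow T_1$ such that $T_{\max}(u_0)\le T_1$ and every weak solution $u$ on any $Q_T$ satisfies $\mu(t)\le u(t,x)$ for some $x\in\Omega$ (depending on $t$), for each $t\in[0,T)$. **Theorem.** If $q>\max\{s,p-1,1\}$, then the solution of (P) blows up in finite time for some large $u_0>0$. Precisely: there is an admissible $u_0$ with $u_0>0$ in $\Omega$ whose solution blows up in finite time; and, for every admissible $\varphi$, there is $c_0>0$ such that the solution with initial datum $u_0=c\varphi$ blows up in finite time for every $c\ge c_0$. -/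

import Mathlib

open MeasureTheory Set Filter Topology
open scoped ContDiff ENNReal

noncomputable section

/-- A stratified Lie group `(ℝ^N, ∘)`. The coordinate `i` lies in the stratum `weight i`, so that
`ℝ^N` is the product of the spaces `ℝ^{N_k}`, `N_k` being the number of `i` with `weight i = k`. -/
structure StratifiedGroupLaw (N : ℕ) where
  /-- the group law on `ℝ^N` -/
  group : Group (EuclideanSpace ℝ (Fin N))
  contDiff_mul : ContDiff ℝ ∞
    fun z : EuclideanSpace ℝ (Fin N) × EuclideanSpace ℝ (Fin N) => group.mul z.1 z.2
  contDiff_inv : ContDiff ℝ ∞ fun x : EuclideanSpace ℝ (Fin N) => group.inv x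
  /-- the stratum of a coordinate -/
  weight : Fin N → ℕ
  weight_pos : ∀ i, 1 ≤ weight i

end

noncomputable section

namespace StratifiedGroupLaw

variable {N : ℕ} (G : StratifiedGroupLaw N)

/-- The dilation `δ_c (x', …, x^{(r)}) = (c x', …, c^r x^{(r)})`. -/
def dilation (c : ℝ) (x : EuclideanSpace ℝ (Fin N)) : EuclideanSpace ℝ (Fin N) :=
  WithLp.toLp 2 fun i => c ^ G.weight i * x i

/-- The indices of the first stratum. -/
abbrev HIndex : Type := {i : Fin N // G.weight i = 1}

/-- The space `ℝ^{N_1}` of horizontal vectors, with its Euclidean norm. -/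
abbrev HSpace : Type := EuclideanSpace ℝ G.HIndex

/-- The left invariant vector field `X_j` with `X_j(0) = ∂/∂x_j` (the unit element is `0`, being
fixed by all dilations): the derivative at `y = 0` of `y ↦ x ∘ y` in the direction `e_j`. -/
def field (j : G.HIndex) (x : EuclideanSpace ℝ (Fin N)) : EuclideanSpace ℝ (Fin N) :=
  fderiv ℝ (fun y => G.group.mul x y) 0 (EuclideanSpace.single j.1 1)

/-- The iterated commutators of the vector fields `X_j`. -/
inductive IsIteratedBracket :
    (EuclideanSpace ℝ (Fin N) → EuclideanSpace ℝ (Fin N)) → Prop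
  | field (j : G.HIndex) : IsIteratedBracket (G.field j)
  | bracket {V W : EuclideanSpace ℝ (Fin N) → EuclideanSpace ℝ (Fin N)} :
      IsIteratedBracket V → IsIteratedBracket W →
        IsIteratedBracket (VectorField.lieBracket ℝ V W)

end StratifiedGroupLaw

/-- A stratified Lie group: the dilations are automorphisms, and the horizontal vector fields
satisfy the Hörmander condition at every point. -/
structure StratifiedGroup (N : ℕ) extends StratifiedGroupLaw N where
  dilation_mul : ∀ c : ℝ, 0 < c → ∀ x y,
    toStratifiedGroupLaw.dilation c (group.mul x y) =
      group.mul (toStratifiedGroupLaw.dilation c x) (toStratifiedGroupLaw.dilation c y)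
  hormander : ∀ x, Submodule.span ℝ
    {v | ∃ V, toStratifiedGroupLaw.IsIteratedBracket V ∧ V x = v} = ⊤

namespace StratifiedGroup

variable {N : ℕ} (G : StratifiedGroup N)

/-- The horizontal gradient `∇_H f = (X_1 f, …, X_{N_1} f)`. -/
def hGrad (f : EuclideanSpace ℝ (Fin N) → ℝ) (x : EuclideanSpace ℝ (Fin N)) : G.HSpace :=
  WithLp.toLp 2 fun j => fderiv ℝ f x (G.field j x)

/-- `f` belongs to `S_0^{1,m}(Ω)`, the completion of `C_0^∞(Ω)` in the norm of
`f ↦ (f, ∇_H f) ∈ L^m(Ω)`, and `g` is its (weak) horizontal gradient. -/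
def IsS0 (Ω : Set (EuclideanSpace ℝ (Fin N))) (m : ℝ≥0∞)
    (f : EuclideanSpace ℝ (Fin N) → ℝ) (g : EuclideanSpace ℝ (Fin N) → G.HSpace) : Prop :=
  MemLp f m (volume.restrict Ω) ∧ MemLp g m (volume.restrict Ω) ∧
  ∃ ψ : ℕ → EuclideanSpace ℝ (Fin N) → ℝ,
    (∀ k, ContDiff ℝ ∞ (ψ k) ∧ HasCompactSupport (ψ k) ∧ tsupport (ψ k) ⊆ Ω) ∧
    Tendsto (fun k => eLpNorm (fun x => ψ k x - f x) m (volume.restrict Ω)) atTop (𝓝 0) ∧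
    Tendsto (fun k => eLpNorm (fun x => G.hGrad (ψ k) x - g x) m (volume.restrict Ω))
      atTop (𝓝 0)

/-- Lebesgue measure on the cylinder `Q_T = (0,T) × Ω`. -/
def cylMeasure (T : ℝ) (Ω : Set (EuclideanSpace ℝ (Fin N))) :
    Measure (ℝ × EuclideanSpace ℝ (Fin N)) :=
  volume.restrict (Ioo 0 T ×ˢ Ω)

/-- `u ∈ L^m((0,T); S_0^{1,m}(Ω))`, with horizontal gradient `g`. -/
def IsBochnerS0 (T : ℝ) (Ω : Set (EuclideanSpace ℝ (Fin N))) (m : ℝ≥0∞)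
    (u : ℝ → EuclideanSpace ℝ (Fin N) → ℝ)
    (g : ℝ → EuclideanSpace ℝ (Fin N) → G.HSpace) : Prop :=
  MemLp (fun z : ℝ × EuclideanSpace ℝ (Fin N) => u z.1 z.2) m (cylMeasure T Ω) ∧
  MemLp (fun z : ℝ × EuclideanSpace ℝ (Fin N) => g z.1 z.2) m (cylMeasure T Ω) ∧
  ∀ᵐ t ∂(volume.restrict (Ioo 0 T)), G.IsS0 Ω m (u t) (g t)

/-- `∂_t u = w ∈ L²((0,T); L²(Ω))` in the sense of distributions on `Q_T`. -/
def IsTimeDeriv (T : ℝ) (Ω : Set (EuclideanSpace ℝ (Fin N)))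
    (u w : ℝ → EuclideanSpace ℝ (Fin N) → ℝ) : Prop :=
  MemLp (fun z : ℝ × EuclideanSpace ℝ (Fin N) => w z.1 z.2) 2 (cylMeasure T Ω) ∧
  ∀ η : ℝ × EuclideanSpace ℝ (Fin N) → ℝ, ContDiff ℝ ∞ η → HasCompactSupport η →
    tsupport η ⊆ Ioo 0 T ×ˢ Ω →
    ∫ z, u z.1 z.2 * fderiv ℝ η z (1, 0) ∂(cylMeasure T Ω) =
      -∫ z, w z.1 z.2 * η z ∂(cylMeasure T Ω)

/-- The regularity asked of sub- and super-solutions: `u` is nonnegative,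
`u ∈ C([0,T) × closure Ω) ∩ L^m((0,T); S_0^{1,m}(Ω))` and `∂_t u ∈ L²((0,T); L²(Ω))`. Here
`g` is the horizontal gradient and `w` the time derivative of `u`. -/
def IsRegular (T : ℝ) (Ω : Set (EuclideanSpace ℝ (Fin N))) (m : ℝ)
    (u : ℝ → EuclideanSpace ℝ (Fin N) → ℝ)
    (g : ℝ → EuclideanSpace ℝ (Fin N) → G.HSpace)
    (w : ℝ → EuclideanSpace ℝ (Fin N) → ℝ) : Prop :=
  (∀ t ∈ Ico 0 T, ∀ x ∈ closure Ω, 0 ≤ u t x) ∧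
  ContinuousOn (fun z : ℝ × EuclideanSpace ℝ (Fin N) => u z.1 z.2) (Ico 0 T ×ˢ closure Ω) ∧
  G.IsBochnerS0 T Ω (ENNReal.ofReal m) u g ∧
  IsTimeDeriv T Ω u w

/-- Nonnegative test functions: `φ ∈ C(closure Q_T) ∩ L^p((0,T); S_0^{1,p}(Ω))`, `φ ≥ 0`,
`φ = 0` on `(0,T) × ∂Ω`. Here `h` is the horizontal gradient of `φ`. -/
def IsTest (T : ℝ) (Ω : Set (EuclideanSpace ℝ (Fin N))) (p : ℝ)
    (φ : ℝ → EuclideanSpace ℝ (Fin N) → ℝ)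
    (h : ℝ → EuclideanSpace ℝ (Fin N) → G.HSpace) : Prop :=
  ContinuousOn (fun z : ℝ × EuclideanSpace ℝ (Fin N) => φ z.1 z.2) (Icc 0 T ×ˢ closure Ω) ∧
  (∀ t ∈ Icc 0 T, ∀ x ∈ closure Ω, 0 ≤ φ t x) ∧
  (∀ t ∈ Ioo 0 T, ∀ x ∈ frontier Ω, φ t x = 0) ∧
  G.IsBochnerS0 T Ω (ENNReal.ofReal p) φ h

/-- `∬ ∂_t u φ + |∇_H u|^{p-2} ∇_H u · ∇_H φ` over `Q_T`. -/
def parabolicForm (T : ℝ) (Ω : Set (EuclideanSpace ℝ (Fin N))) (p : ℝ)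
    (g : ℝ → EuclideanSpace ℝ (Fin N) → G.HSpace)
    (w φ : ℝ → EuclideanSpace ℝ (Fin N) → ℝ)
    (h : ℝ → EuclideanSpace ℝ (Fin N) → G.HSpace) : ℝ :=
  ∫ z, (w z.1 z.2 * φ z.1 z.2 +
    ‖g z.1 z.2‖ ^ (p - 2) * inner ℝ (g z.1 z.2) (h z.1 z.2)) ∂(cylMeasure T Ω)

/-- `∬ (α |u|^{q-1} u + γ |u|^{s-1} u) φ` over `Q_T`. -/
def sourceForm (T : ℝ) (Ω : Set (EuclideanSpace ℝ (Fin N))) (α γ q s : ℝ)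
    (u φ : ℝ → EuclideanSpace ℝ (Fin N) → ℝ) : ℝ :=
  ∫ z, (α * (|u z.1 z.2| ^ (q - 1) * u z.1 z.2) + γ * (|u z.1 z.2| ^ (s - 1) * u z.1 z.2)) *
    φ z.1 z.2 ∂(cylMeasure T Ω)

/-- `u` is a weak sub-solution on `Q_T` of
`u_t - ∇_H · (|∇_H u|^{p-2} ∇_H u) = α |u|^{q-1} u + γ |u|^{s-1} u`,
`u = 0` on `∂Ω`, `u(0, ·) = u₀`, with horizontal gradient `g` and time derivative `w`. -/
def IsWeakSub (T : ℝ) (Ω : Set (EuclideanSpace ℝ (Fin N))) (α γ p q s : ℝ)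
    (u₀ : EuclideanSpace ℝ (Fin N) → ℝ) (u : ℝ → EuclideanSpace ℝ (Fin N) → ℝ)
    (g : ℝ → EuclideanSpace ℝ (Fin N) → G.HSpace)
    (w : ℝ → EuclideanSpace ℝ (Fin N) → ℝ) : Prop :=
  G.IsRegular T Ω (max p (max q s)) u g w ∧
  (∀ x ∈ Ω, u 0 x ≤ u₀ x) ∧
  (∀ t ∈ Ioo 0 T, ∀ x ∈ frontier Ω, u t x ≤ 0) ∧
  ∀ φ h, G.IsTest T Ω p φ h →
    G.parabolicForm T Ω p g w φ h ≤ sourceForm T Ω α γ q s u φ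

/-- `u` is a weak super-solution on `Q_T` of the same problem. -/
def IsWeakSuper (T : ℝ) (Ω : Set (EuclideanSpace ℝ (Fin N))) (α γ p q s : ℝ)
    (u₀ : EuclideanSpace ℝ (Fin N) → ℝ) (u : ℝ → EuclideanSpace ℝ (Fin N) → ℝ)
    (g : ℝ → EuclideanSpace ℝ (Fin N) → G.HSpace)
    (w : ℝ → EuclideanSpace ℝ (Fin N) → ℝ) : Prop :=
  G.IsRegular T Ω (max p (max q s)) u g w ∧
  (∀ x ∈ Ω, u₀ x ≤ u 0 x) ∧
  (∀ t ∈ Ioo 0 T, ∀ x ∈ frontier Ω, 0 ≤ u t x) ∧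
  ∀ φ h, G.IsTest T Ω p φ h →
    sourceForm T Ω α γ q s u φ ≤ G.parabolicForm T Ω p g w φ h

/-- A weak solution on `Q_T`: a weak sub-solution that is also a weak super-solution. (The
functions `g = ∇_H u` and `w = ∂_t u` are determined by `u` almost everywhere.) -/
def IsWeakSolution (T : ℝ) (Ω : Set (EuclideanSpace ℝ (Fin N))) (α γ p q s : ℝ)
    (u₀ : EuclideanSpace ℝ (Fin N) → ℝ) (u : ℝ → EuclideanSpace ℝ (Fin N) → ℝ) : Prop :=
  ∃ g w, G.IsWeakSub T Ω α γ p q s u₀ u g w ∧ G.IsWeakSuper T Ω α γ p q s u₀ u g w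

/-- Initial data: `u₀ ∈ S_0^{1,∞}(Ω)` (its continuous representative), `u₀ ≥ 0`, `u₀ ≢ 0`. -/
def IsInitialDatum (Ω : Set (EuclideanSpace ℝ (Fin N)))
    (u₀ : EuclideanSpace ℝ (Fin N) → ℝ) : Prop :=
  (∃ g, G.IsS0 Ω ⊤ u₀ g) ∧ ContinuousOn u₀ Ω ∧ (∀ x ∈ Ω, 0 ≤ u₀ x) ∧ ∃ x ∈ Ω, u₀ x ≠ 0

/-- The maximal existence time `T_max` of a weak solution with initial datum `u₀`. -/
def maximalTime (Ω : Set (EuclideanSpace ℝ (Fin N))) (α γ p q s : ℝ)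
    (u₀ : EuclideanSpace ℝ (Fin N) → ℝ) : ℝ≥0∞ :=
  ⨆ (T : ℝ) (_ : 0 < T ∧ ∃ u, G.IsWeakSolution T Ω α γ p q s u₀ u), ENNReal.ofReal T

/-- Blow-up in finite time for the initial datum `u₀`: there are a finite time `T₁`, beyond which
no weak solution can be continued, and a function `μ` with `μ(t) → ∞` as `t ↑ T₁`, such that
`sup_Ω u(t, ·) ≥ μ(t)` as long as a weak solution `u` exists. -/
def BlowsUpInFiniteTime (Ω : Set (EuclideanSpace ℝ (Fin N))) (α γ p q s : ℝ)
    (u₀ : EuclideanSpace ℝ (Fin N) → ℝ) : Prop :=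
  ∃ T₁ : ℝ, 0 < T₁ ∧ G.maximalTime Ω α γ p q s u₀ ≤ ENNReal.ofReal T₁ ∧
    ∃ μ : ℝ → ℝ, Tendsto μ (𝓝[<] T₁) atTop ∧
      ∀ T : ℝ, 0 < T → ∀ u, G.IsWeakSolution T Ω α γ p q s u₀ u →
        ∀ t ∈ Ico 0 T, ∃ x ∈ Ω, μ t ≤ u t x

end StratifiedGroup

end

/-! ### The multiplier and its primitive -/

noncomputable section

/-! Blow-up comes from a superlinear inequality for F(t) = ∫ Φ(u(t)) ρ, where ρ = ψ^k is a cutoff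
supported inside Ω and Φ is the primitive of a positive decreasing function H, with H(r) comparable
to (1 + r)^(-1/2) for r ≥ 0. Testing the super-solution inequality with H(u) ρ gives, formally, F' ≥
∫ (α u^q + γ u^s) H(u) ρ - ∫ H'(u) |∇_H u|^p ρ - ∫ H(u) |∇_H u|^(p-2) ∇_H u · ∇_H ρ. A constant
multiplier would leave nothing to control the last integral. Since H' < 0 on r ≥ 0, the middle term
is nonnegative and absorbs it wherever |∇_H u| ψ is large compared with 1 + u. Elsewhere the
gradient is bounded by a multiple of (1 + u)/ψ, and what remains has order (1 + u)^(p - 3/2) ψ^(k -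
p). The main source term has order (1 + u)^(q - 1/2) ψ^k; as q > p - 1 and q > s, it dominates this
remainder and the absorption term, up to a constant, once k is large. This is
`exists_multiplier_estimate`.

Since Φ(r) is at most 2 (1 + r)^(1/2), the surviving source term controls Φ(u)^(2q-1) ρ. Jensen's
inequality (`rpow_integral_mul_le`) then yields F' ≥ c F^(2q-1) - C with 2q - 1 > 1. If F(0) is
large, comparison with an explicit ODE (`exists_blowup_of_superlinear`) bounds the lifetime by a
time T₁ and F from below by a function tending to infinity at T₁, both depending only on F(0) and
the constants, hence common to all weak solutions. As Φ(u) ≤ u, the supremum of u is bounded below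
as well. Finally Φ is unbounded, so F(0) is large for every large multiple of a given datum.

The weak setting requires two justifications. First, H(u) ρ must be an admissible test function: H
is smooth with H and H' bounded, so the composition stays in S_0^{1,p} (`IsS0.comp_mul`). Second, ∫
u_t H(u) ρ must be the derivative of F although u_t is only a distributional derivative: for almost
every x the slice u(·, x) is a primitive of an integrable function, and the chain rule holds for
absolutely continuous functions (`IsTimeDeriv.integral_comp_sub`). -/

/-- A smooth positive decreasing multiplier, comparable with `(1 + r)^(-1/2)` for `r ≥ 0`. -/
def multiplier (r : ℝ) : ℝ := (1 + (1 + r) ^ 2) ^ (-(1 / 4) : ℝ)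

/-- The derivative of `multiplier`. -/
def multiplierDeriv (r : ℝ) : ℝ := -(1 / 2) * (1 + r) * (1 + (1 + r) ^ 2) ^ (-(5 / 4) : ℝ)

/-- The primitive of `multiplier` that vanishes at `0`. -/
def multiplierPrim (r : ℝ) : ℝ := ∫ y in (0 : ℝ)..r, multiplier y

lemma multiplier_pos (r : ℝ) : 0 < multiplier r := by
  unfold multiplier; positivity

lemma multiplier_le_one (r : ℝ) : multiplier r ≤ 1 :=
  Real.rpow_le_one_of_one_le_of_nonpos (by nlinarith [sq_nonneg (1 + r)]) (by norm_num)

/-- The base of the power is at least 1 on the whole line. Smoothness at negative arguments matters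
because the multiplier is also applied to the smooth approximants of u, which need not be
nonnegative. -/
lemma contDiff_multiplier : ContDiff ℝ ∞ multiplier := by
  unfold multiplier
  refine ContDiff.rpow_const_of_ne (by fun_prop) fun x => ?_
  positivity

lemma continuous_multiplier : Continuous multiplier := contDiff_multiplier.continuous

lemma hasDerivAt_multiplier (r : ℝ) : HasDerivAt multiplier (multiplierDeriv r) r := by
  have h1 : HasDerivAt (fun r : ℝ => 1 + (1 + r) ^ 2) (2 * (1 + r)) r := by
    have := (((hasDerivAt_id r).const_add 1).pow 2).const_add 1
    simpa using this
  have h2 := h1.rpow_const (p := (-(1 / 4) : ℝ)) (Or.inl (by positivity))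
  refine h2.congr_deriv ?_
  unfold multiplierDeriv
  rw [show (-(1 / 4) - 1 : ℝ) = -(5 / 4) by norm_num]
  ring

lemma continuous_multiplierDeriv : Continuous multiplierDeriv := by
  unfold multiplierDeriv
  refine Continuous.mul (by fun_prop) (Continuous.rpow_const (by fun_prop) fun x => Or.inl ?_)
  positivity

lemma abs_multiplierDeriv_le (r : ℝ) : |multiplierDeriv r| ≤ 1 := by
  unfold multiplierDeriv
  have hA : 1 ≤ 1 + (1 + r) ^ 2 := by nlinarith [sq_nonneg (1 + r)]
  have hle : (1 + (1 + r) ^ 2) ^ (-(5 / 4) : ℝ) ≤ (1 + (1 + r) ^ 2) ^ (-1 : ℝ) :=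
    Real.rpow_le_rpow_of_exponent_le hA (by norm_num)
  rw [Real.rpow_neg_one] at hle
  rw [abs_mul, abs_of_pos (show 0 < (1 + (1 + r) ^ 2) ^ (-(5 / 4) : ℝ) by positivity)]
  have h2 : |-(1 / 2) * (1 + r)| ≤ 1 + (1 + r) ^ 2 := by
    rw [abs_le]; constructor <;> nlinarith [sq_nonneg (1 + r), sq_nonneg r]
  calc _ ≤ (1 + (1 + r) ^ 2) * (1 + (1 + r) ^ 2)⁻¹ := by gcongr
    _ = 1 := mul_inv_cancel₀ (by positivity)

lemma multiplier_le {r : ℝ} (hr : 0 ≤ r) : multiplier r ≤ (1 + r) ^ (-(1 / 2) : ℝ) := by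
  unfold multiplier
  calc _ ≤ ((1 + r) ^ 2) ^ (-(1 / 4) : ℝ) :=
        Real.rpow_le_rpow_of_nonpos (by positivity) (by linarith) (by norm_num)
    _ = _ := by
        rw [← Real.rpow_natCast, ← Real.rpow_mul (by positivity)]; norm_num

lemma le_multiplier {r : ℝ} (hr : 0 ≤ r) : (1 / 2) * (1 + r) ^ (-(1 / 2) : ℝ) ≤ multiplier r := by
  unfold multiplier
  calc (1 / 2) * (1 + r) ^ (-(1 / 2) : ℝ) ≤ 2 ^ (-(1 / 4) : ℝ) * ((1 + r) ^ 2) ^ (-(1 / 4) : ℝ) := by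
        rw [← Real.rpow_natCast, ← Real.rpow_mul (by positivity)]
        have : (1 / 2 : ℝ) ≤ 2 ^ (-(1 / 4) : ℝ) := by
          rw [show (1 / 2 : ℝ) = 2 ^ (-1 : ℝ) by norm_num]
          exact Real.rpow_le_rpow_of_exponent_le (by norm_num) (by norm_num)
        norm_num at this ⊢
        gcongr
    _ = (2 * (1 + r) ^ 2) ^ (-(1 / 4) : ℝ) := (Real.mul_rpow (by norm_num) (by positivity)).symm
    _ ≤ _ := Real.rpow_le_rpow_of_nonpos (by positivity) (by nlinarith) (by norm_num)

/-- This lower bound is the coefficient of the coercive gradient term; it is smaller than the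
multiplier only by one power of 1 + r. -/
lemma le_neg_multiplierDeriv {r : ℝ} (hr : 0 ≤ r) :
    (1 / 8) * (1 + r) ^ (-(3 / 2) : ℝ) ≤ -multiplierDeriv r := by
  unfold multiplierDeriv
  have h1 : (1 / 4 : ℝ) ≤ 2 ^ (-(5 / 4) : ℝ) := by
    rw [show (1 / 4 : ℝ) = 2 ^ (-2 : ℝ) by norm_num]
    exact Real.rpow_le_rpow_of_exponent_le (by norm_num) (by norm_num)
  have h2 : (2 : ℝ) ^ (-(5 / 4) : ℝ) * (1 + r) ^ (-(5 / 2) : ℝ) ≤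
      (1 + (1 + r) ^ 2) ^ (-(5 / 4) : ℝ) := by
    calc _ = 2 ^ (-(5 / 4) : ℝ) * ((1 + r) ^ 2) ^ (-(5 / 4) : ℝ) := by
          rw [← Real.rpow_natCast, ← Real.rpow_mul (by positivity)]; norm_num
      _ = (2 * (1 + r) ^ 2) ^ (-(5 / 4) : ℝ) := (Real.mul_rpow (by norm_num) (by positivity)).symm
      _ ≤ _ := Real.rpow_le_rpow_of_nonpos (by positivity) (by nlinarith) (by norm_num)
  have h3 : (1 + r) ^ (-(3 / 2) : ℝ) = (1 + r) * (1 + r) ^ (-(5 / 2) : ℝ) := by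
    rw [← Real.rpow_one_add' (by positivity) (by norm_num)]; norm_num
  have h4 : 0 < (1 + r) ^ (-(5 / 2) : ℝ) := by positivity
  have h5 : (1 / 4) * (1 + r) ^ (-(5 / 2) : ℝ) ≤ (1 + (1 + r) ^ 2) ^ (-(5 / 4) : ℝ) :=
    (mul_le_mul_of_nonneg_right h1 h4.le).trans h2
  rw [h3]
  nlinarith [mul_le_mul_of_nonneg_left h5 (show 0 ≤ 1 + r by linarith)]

lemma hasDerivAt_multiplierPrim (r : ℝ) : HasDerivAt multiplierPrim (multiplier r) r :=
  intervalIntegral.integral_hasDerivAt_right (continuous_multiplier.intervalIntegrable _ _)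
    (continuous_multiplier.stronglyMeasurableAtFilter _ _) continuous_multiplier.continuousAt

lemma continuous_multiplierPrim : Continuous multiplierPrim :=
  continuous_iff_continuousAt.2 fun r => (hasDerivAt_multiplierPrim r).continuousAt

lemma monotone_multiplierPrim : Monotone multiplierPrim :=
  monotone_of_deriv_nonneg (fun r => (hasDerivAt_multiplierPrim r).differentiableAt) fun r => by
    rw [(hasDerivAt_multiplierPrim r).deriv]; exact (multiplier_pos r).le

lemma lipschitzWith_multiplierPrim : LipschitzWith 1 multiplierPrim :=
  lipschitzWith_of_nnnorm_deriv_le (fun r => (hasDerivAt_multiplierPrim r).differentiableAt)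
    fun r => by
      rw [(hasDerivAt_multiplierPrim r).deriv, ← NNReal.coe_le_coe]
      simpa [abs_of_pos (multiplier_pos r)] using multiplier_le_one r

@[simp] lemma multiplierPrim_zero : multiplierPrim 0 = 0 := by simp [multiplierPrim]

lemma multiplierPrim_nonneg {r : ℝ} (hr : 0 ≤ r) : 0 ≤ multiplierPrim r := by
  simpa using monotone_multiplierPrim hr

lemma multiplierPrim_le_self {r : ℝ} (hr : 0 ≤ r) : multiplierPrim r ≤ r := by
  have h := lipschitzWith_multiplierPrim.dist_le_mul r 0
  simp only [Real.dist_eq, multiplierPrim_zero, sub_zero, NNReal.coe_one, one_mul] at h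
  rw [abs_of_nonneg hr] at h
  exact (le_abs_self _).trans h

/-- Integrate the upper bound on the multiplier. The growth 1/2 makes the power 2q - 1 of the
primitive match (1 + r)^(q - 1/2), the order of the source term times the multiplier. -/
lemma multiplierPrim_le {r : ℝ} (hr : 0 ≤ r) : multiplierPrim r ≤ 2 * (1 + r) ^ (1 / 2 : ℝ) := by
  have hd : ∀ x ∈ Ici (0 : ℝ), HasDerivAt (fun r => 2 * (1 + r) ^ (1 / 2 : ℝ) - multiplierPrim r)
      ((1 + x) ^ (-(1 / 2) : ℝ) - multiplier x) x := fun x hx => by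
    have hx : 0 ≤ x := hx
    have h1 := (((hasDerivAt_id x).const_add 1).rpow_const (p := (1 / 2 : ℝ))
      (Or.inl (by simp only [id]; positivity))).const_mul 2
    refine (h1.sub (hasDerivAt_multiplierPrim x)).congr_deriv ?_
    norm_num
    ring
  have hm : MonotoneOn (fun r => 2 * (1 + r) ^ (1 / 2 : ℝ) - multiplierPrim r) (Ici 0) := by
    refine monotoneOn_of_deriv_nonneg (convex_Ici 0)
      (fun x hx => (hd x hx).continuousAt.continuousWithinAt)
      (fun x hx => (hd x (interior_subset hx)).differentiableAt.differentiableWithinAt)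
      fun x hx => ?_
    rw [(hd x (interior_subset hx)).deriv]
    exact sub_nonneg.2 (multiplier_le (interior_subset hx))
  have := hm self_mem_Ici hr hr
  simp at this
  norm_num
  linarith

/-- On [0, r] the multiplier is at least a constant times (1 + r)^(-1/2), so its primitive grows at
least like r^(1/2). This lets large multiples of a datum reach any threshold. -/
lemma tendsto_multiplierPrim : Tendsto multiplierPrim atTop atTop := by
  have key : ∀ r : ℝ, 1 ≤ r → (1 / 4) * r ^ (1 / 2 : ℝ) ≤ multiplierPrim r := fun r hr => by
    have h0 : 0 ≤ r := by linarith
    have h1 := (convex_Icc 0 r).mul_sub_le_image_sub_of_le_deriv (f := multiplierPrim)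
      continuous_multiplierPrim.continuousOn
      (fun x _ => (hasDerivAt_multiplierPrim x).differentiableAt.differentiableWithinAt)
      (C := (1 / 2) * (1 + r) ^ (-(1 / 2) : ℝ)) (fun x hx => by
        rw [(hasDerivAt_multiplierPrim x).deriv]
        have hx := interior_subset hx
        have hx0 : 0 ≤ x := hx.1
        refine le_trans ?_ (le_multiplier hx.1)
        have := Real.rpow_le_rpow_of_nonpos (z := (-(1 / 2) : ℝ)) (show 0 < 1 + x by linarith)
          (show 1 + x ≤ 1 + r by linarith [hx.2]) (by norm_num)
        linarith) 0 ⟨le_rfl, h0⟩ r ⟨h0, le_rfl⟩ h0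
    simp only [multiplierPrim_zero, sub_zero] at h1
    refine le_trans ?_ h1
    have h2 : (4 * r) ^ (-(1 / 2) : ℝ) ≤ (1 + r) ^ (-(1 / 2) : ℝ) :=
      Real.rpow_le_rpow_of_nonpos (by positivity) (by linarith) (by norm_num)
    have h3 : (4 * r) ^ (-(1 / 2) : ℝ) = (1 / 2) * r ^ (-(1 / 2) : ℝ) := by
      rw [Real.mul_rpow (by norm_num) h0, show (4 : ℝ) = 2 ^ (2 : ℝ) by norm_num,
        ← Real.rpow_mul (by norm_num)]
      norm_num
    have h4 : r ^ (1 / 2 : ℝ) = r ^ (-(1 / 2) : ℝ) * r := by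
      rw [← Real.rpow_add_one (by positivity)]; norm_num
    rw [h4]
    nlinarith
  refine tendsto_atTop_mono' _ ?_
    ((tendsto_rpow_atTop (show (0 : ℝ) < 1 / 2 by norm_num)).const_mul_atTop
      (show (0 : ℝ) < 1 / 4 by norm_num))
  filter_upwards [eventually_ge_atTop 1] with r hr using key r hr


/-! ### Pointwise absorption estimates -/

/-- A lower power is absorbed by a higher one, up to a constant. -/
lemma exists_const_mul_rpow_le {τ K ε : ℝ} (hτ0 : 0 ≤ τ) (hτ : τ < 1) (hK : 0 ≤ K) (hε : 0 < ε) :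
    ∃ C : ℝ, 0 ≤ C ∧ ∀ z : ℝ, 0 ≤ z → K * z ^ τ ≤ ε * z + C := by
  -- The crossover point, where K z^τ = ε z: below it K z^τ is bounded by its value there, above it
  -- the linear term wins.
  set z₀ : ℝ := (K / ε) ^ (1 / (1 - τ)) with hz₀
  have h1τ : 0 < 1 - τ := by linarith
  have hz₀0 : 0 ≤ z₀ := by positivity
  refine ⟨K * z₀ ^ τ, by positivity, fun z hz => ?_⟩
  rcases le_total z z₀ with h | h
  · have : z ^ τ ≤ z₀ ^ τ := Real.rpow_le_rpow hz h hτ0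
    nlinarith [mul_le_mul_of_nonneg_left this hK]
  · rcases hz.eq_or_lt with rfl | hzp
    · rw [le_antisymm h hz₀0]; simp
    have h1 : K / ε ≤ z ^ (1 - τ) := by
      have := Real.rpow_le_rpow hz₀0 h h1τ.le
      rwa [hz₀, ← Real.rpow_mul (by positivity), one_div_mul_cancel h1τ.ne', Real.rpow_one] at this
    rw [div_le_iff₀ hε] at h1
    have h2 : z = z ^ (1 - τ) * z ^ τ := by
      rw [← Real.rpow_add hzp]; simp
    have h3 : 0 ≤ z ^ τ := by positivity
    have h4 : 0 ≤ z₀ ^ τ := by positivity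
    have := mul_le_mul_of_nonneg_right h1 h3
    nlinarith [mul_nonneg hK h4]

/-- The gradient terms produced by the test function are bounded below by a power of the solution. -/
lemma multiplier_gradient_estimate {p m τ C₀ r a y : ℝ} {k : ℕ} (hp : 1 < p) (hm : p - 1 ≤ m)
    (hτ0 : 0 ≤ τ) (hkp : p + k * τ ≤ k) (hC₀ : 0 ≤ C₀) (hr : 0 ≤ r) (ha : 0 ≤ a) (hy : 0 ≤ y)
    (hy1 : y ≤ 1) :
    -(C₀ * (8 * C₀) ^ (p - 1) * ((y ^ k) ^ τ * (1 + r) ^ (m - 1 / 2))) ≤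
      -multiplierDeriv r * y ^ k * a ^ p - multiplier r * (a ^ (p - 1) * (C₀ * y ^ (k - 1))) := by
  set R : ℝ := 1 + r with hR
  set K : ℝ := C₀ * (8 * C₀) ^ (p - 1) with hK
  rw [← mul_assoc]
  have hK0 : 0 ≤ K := by positivity
  have hR1 : 1 ≤ R := by linarith
  have hR0 : 0 < R := by linarith
  have h1k : (1 : ℝ) < k := by nlinarith [mul_nonneg (Nat.cast_nonneg (α := ℝ) k) hτ0]
  have h2k : 2 ≤ k := by exact_mod_cast h1k
  have hk1 : 1 ≤ k := by omega
  have hHle := multiplier_le hr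
  have hHd := le_neg_multiplierDeriv hr
  rw [← hR] at hHle hHd
  have hX : (1 / 8 * R ^ (-(3 / 2) : ℝ)) * y ^ k * a ^ p ≤ -multiplierDeriv r * y ^ k * a ^ p := by
    gcongr
  have hY : multiplier r * (a ^ (p - 1) * (C₀ * y ^ (k - 1))) ≤
      R ^ (-(1 / 2) : ℝ) * (a ^ (p - 1) * (C₀ * y ^ (k - 1))) := by gcongr
  have hap : a ^ p = a ^ (p - 1) * a := by
    rw [← Real.rpow_add_one' ha (by linarith)]; simp
  have hyk : y ^ k = y ^ (k - 1) * y := by rw [← pow_succ, Nat.sub_add_cancel hk1]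
  have hR3 : R ^ (-(1 / 2) : ℝ) = R ^ (-(3 / 2) : ℝ) * R := by
    rw [← Real.rpow_add_one hR0.ne']; norm_num
  -- The quotient of the coercive lower bound by the upper bound for the flux term is y a / (8 C₀
  -- R). Either it is at least 1 and the flux term is absorbed, or a is bounded by 8 C₀ R / y.
  rcases le_or_gt (8 * C₀ * R) (y * a) with h | h
  · have : R ^ (-(1 / 2) : ℝ) * (a ^ (p - 1) * (C₀ * y ^ (k - 1))) ≤
        (1 / 8 * R ^ (-(3 / 2) : ℝ)) * y ^ k * a ^ p := by
      calc _ = (1 / 8 * R ^ (-(3 / 2) : ℝ)) * (a ^ (p - 1) * y ^ (k - 1)) * (8 * C₀ * R) := by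
            rw [hR3]; ring
        _ ≤ (1 / 8 * R ^ (-(3 / 2) : ℝ)) * (a ^ (p - 1) * y ^ (k - 1)) * (y * a) := by gcongr
        _ = _ := by rw [hap, hyk]; ring
    linarith [show 0 ≤ K * (y ^ k) ^ τ * R ^ (m - 1 / 2) by positivity]
  · have hXn : 0 ≤ (1 / 8 * R ^ (-(3 / 2) : ℝ)) * y ^ k * a ^ p := by positivity
    suffices R ^ (-(1 / 2) : ℝ) * (a ^ (p - 1) * (C₀ * y ^ (k - 1))) ≤
        K * (y ^ k) ^ τ * R ^ (m - 1 / 2) by linarith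
    rcases hy.eq_or_lt with rfl | hy0
    · rw [zero_pow (by omega)]
      simp only [mul_zero]; positivity
    have h1 : (y * a) ^ (p - 1) ≤ (8 * C₀ * R) ^ (p - 1) :=
      Real.rpow_le_rpow (by positivity) h.le (by linarith)
    -- The factor y^(p-1) pairs with a^(p-1), so that only the product y a has to be bounded; the
    -- leftover y^(k-p) is handled by the choice of k.
    have h2 : y ^ (k - 1) = y ^ (p - 1) * y ^ ((k : ℝ) - p) := by
      rw [← Real.rpow_add hy0, ← Real.rpow_natCast, Nat.cast_sub hk1]; congr 1; push_cast; ring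
    have h3 : y ^ ((k : ℝ) - p) ≤ (y ^ k) ^ τ := by
      rw [← Real.rpow_natCast, ← Real.rpow_mul hy]
      exact Real.rpow_le_rpow_of_exponent_ge hy0 hy1 (by linarith)
    have h4 : R ^ (-(1 / 2) : ℝ) * R ^ (p - 1) ≤ R ^ (m - 1 / 2) := by
      rw [← Real.rpow_add hR0]
      exact Real.rpow_le_rpow_of_exponent_le hR1 (by linarith)
    calc R ^ (-(1 / 2) : ℝ) * (a ^ (p - 1) * (C₀ * y ^ (k - 1)))
        = R ^ (-(1 / 2) : ℝ) * C₀ * (y * a) ^ (p - 1) * y ^ ((k : ℝ) - p) := by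
          rw [h2, Real.mul_rpow hy ha]; ring
      _ ≤ R ^ (-(1 / 2) : ℝ) * C₀ * (8 * C₀ * R) ^ (p - 1) * (y ^ k) ^ τ := by gcongr
      _ = K * (y ^ k) ^ τ * (R ^ (-(1 / 2) : ℝ) * R ^ (p - 1)) := by
          rw [Real.mul_rpow (show 0 ≤ 8 * C₀ by positivity) hR0.le, hK]; ring
      _ ≤ K * (y ^ k) ^ τ * R ^ (m - 1 / 2) := by gcongr

set_option maxHeartbeats 800000 in
/-- The pointwise estimate behind blow-up. Here `r` is the value of the solution, `a` the norm of
its gradient, and `y ^ k` the value of the localizing weight. -/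
lemma exists_multiplier_estimate {α γ p q s : ℝ} (hα : 0 < α) (hp : 1 < p) (hs : 0 < s)
    (hq : max s (max (p - 1) 1) < q) :
    ∃ k : ℕ, 1 ≤ k ∧ ∀ C₀ : ℝ, 0 ≤ C₀ → ∃ c C : ℝ, 0 < c ∧ 0 ≤ C ∧
      ∀ r a y : ℝ, 0 ≤ r → 0 ≤ a → 0 ≤ y → y ≤ 1 →
        c * (multiplierPrim r ^ (2 * q - 1) * y ^ k) - C ≤
          -multiplierDeriv r * y ^ k * a ^ p - multiplier r * (a ^ (p - 1) * (C₀ * y ^ (k - 1))) +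
            (α * r ^ q + γ * r ^ s) * (multiplier r * y ^ k) := by
  simp only [max_lt_iff] at hq
  obtain ⟨hsq, hpq, h1q⟩ := hq
  -- The maximum with 1, here and in σ below, keeps the exponents τ and τ' nonnegative even if p - 1
  -- or s is below 1/2.
  set m : ℝ := max (p - 1) 1 with hm
  have hm1 : 1 ≤ m := le_max_right _ _
  have hmq : m < q := max_lt hpq h1q
  set σ : ℝ := max s 1 with hσ
  have hσ1 : 1 ≤ σ := le_max_right _ _
  have hσq : σ < q := max_lt hsq h1q
  have hq' : 0 < q - 1 / 2 := by linarith
  set τ : ℝ := (m - 1 / 2) / (q - 1 / 2) with hτ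
  set τ' : ℝ := (σ - 1 / 2) / (q - 1 / 2) with hτ'
  have hτ0 : 0 ≤ τ := div_nonneg (by linarith) hq'.le
  have hτ'0 : 0 ≤ τ' := div_nonneg (by linarith) hq'.le
  have hτ1 : τ < 1 := (div_lt_one hq').2 (by linarith)
  have hτ'1 : τ' < 1 := (div_lt_one hq').2 (by linarith)
  have hτq : (q - 1 / 2) * τ = m - 1 / 2 := mul_div_cancel₀ _ hq'.ne'
  have hτ'q : (q - 1 / 2) * τ' = σ - 1 / 2 := mul_div_cancel₀ _ hq'.ne'
  -- The bound k ≥ p / (1 - τ) means k - p ≥ k τ, so y^(k-p) ≤ (y^k)^τ for y in [0, 1]; the extra 1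
  -- ensures k ≥ 1. The choice precedes C₀ because C₀ will itself depend on k.
  obtain ⟨k, hk⟩ := exists_nat_ge (p / (1 - τ) + 1)
  have h1τ : 0 < 1 - τ := by linarith
  have hkp : p + k * τ ≤ k := by
    have : p / (1 - τ) ≤ k := by linarith
    rw [div_le_iff₀ h1τ] at this; linarith
  have hk1 : 1 ≤ k := by
    have : (1 : ℝ) ≤ k := le_trans (by linarith [div_nonneg (show 0 ≤ p by linarith) h1τ.le]) hk
    exact_mod_cast this
  refine ⟨k, hk1, fun C₀ hC₀ => ?_⟩
  -- The factor 2^(-q) comes from (1 + r)^q ≤ 2^q (r^q + 1), the factor 1/2 from the lower bound on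
  -- the multiplier.
  set c₁ : ℝ := α * 2 ^ (-q) / 2 with hc₁
  have hc₁0 : 0 < c₁ := by positivity
  set K : ℝ := C₀ * (8 * C₀) ^ (p - 1) with hK
  have hK0 : 0 ≤ K := by positivity
  -- The source supplies c₁ z; the gradient remainder and the absorption term may each consume a
  -- quarter of it, which leaves c₁ z / 2.
  obtain ⟨B₁, hB₁0, hB₁⟩ := exists_const_mul_rpow_le hτ0 hτ1 hK0 (show 0 < c₁ / 4 by positivity)
  obtain ⟨B₂, hB₂0, hB₂⟩ := exists_const_mul_rpow_le hτ'0 hτ'1 (abs_nonneg γ)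
    (show 0 < c₁ / 4 by positivity)
  -- The power of 2 compensates for the factor 2 in the upper bound for the primitive; the α in the
  -- additive constant pays for the 1 in r^q + 1.
  refine ⟨c₁ / 2 * 2 ^ (-(2 * q - 1)), B₁ + B₂ + α, by positivity, by positivity,
    fun r a y hr ha hy hy1 => ?_⟩
  set R : ℝ := 1 + r with hR
  have hR1 : 1 ≤ R := by linarith
  have hR0 : 0 < R := by linarith
  set z : ℝ := y ^ k * R ^ (q - 1 / 2) with hz
  have hz0 : 0 ≤ z := by positivity
  have hyk1 : y ^ k ≤ 1 := pow_le_one₀ hy hy1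
  have hyk0 : 0 ≤ y ^ k := by positivity
  have hH0 := multiplier_pos r
  have hH1 := multiplier_le_one r
  have hHle := multiplier_le hr
  have hleH := le_multiplier hr
  have hHd := le_neg_multiplierDeriv hr
  rw [← hR] at hHle hleH hHd
  -- the quantity that is bounded from below
  have e1 : multiplierPrim r ^ (2 * q - 1) * y ^ k ≤ 2 ^ (2 * q - 1) * z := by
    have h1 : multiplierPrim r ^ (2 * q - 1) ≤ (2 * R ^ (1 / 2 : ℝ)) ^ (2 * q - 1) :=
      Real.rpow_le_rpow (multiplierPrim_nonneg hr) (multiplierPrim_le hr) (by linarith)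
    rw [Real.mul_rpow (by norm_num) (by positivity), ← Real.rpow_mul hR0.le,
      show 1 / 2 * (2 * q - 1) = q - 1 / 2 by ring] at h1
    calc _ ≤ (2 ^ (2 * q - 1) * R ^ (q - 1 / 2)) * y ^ k := by gcongr
      _ = _ := by rw [hz]; ring
  have e1' : c₁ / 2 * 2 ^ (-(2 * q - 1)) * (multiplierPrim r ^ (2 * q - 1) * y ^ k)
      ≤ c₁ / 2 * z := by
    calc _ ≤ c₁ / 2 * 2 ^ (-(2 * q - 1)) * (2 ^ (2 * q - 1) * z) := by gcongr
      _ = c₁ / 2 * (2 ^ (-(2 * q - 1)) * 2 ^ (2 * q - 1)) * z := by ring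
      _ = _ := by rw [← Real.rpow_add (by norm_num)]; simp
  -- the source term
  have e2 : c₁ * z - α ≤ α * r ^ q * (multiplier r * y ^ k) := by
    have h1 : 2 ^ (-q) * R ^ q ≤ r ^ q + 1 := by
      have hR2 : R ≤ 2 * max r 1 := by
        rcases le_total r 1 with h | h
        · rw [max_eq_right h]; linarith
        · rw [max_eq_left h]; linarith
      have h2 : R ^ q ≤ (2 * max r 1) ^ q := Real.rpow_le_rpow hR0.le hR2 (by linarith)
      have h3 : (max r 1) ^ q ≤ r ^ q + 1 := by
        rcases le_total r 1 with h | h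
        · rw [max_eq_right h]; simp; positivity
        · rw [max_eq_left h]; linarith
      rw [Real.mul_rpow (by norm_num) (by positivity)] at h2
      calc (2 : ℝ) ^ (-q) * R ^ q ≤ 2 ^ (-q) * (2 ^ q * (max r 1) ^ q) := by gcongr
        _ = (max r 1) ^ q := by
            rw [← mul_assoc, ← Real.rpow_add (by norm_num)]; simp
        _ ≤ _ := h3
    have h4 : R ^ (q - 1 / 2) = R ^ q * R ^ (-(1 / 2) : ℝ) := by
      rw [← Real.rpow_add hR0]; rfl
    have h5 : multiplier r * y ^ k ≤ 1 := mul_le_one₀ hH1 hyk0 hyk1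
    have h6 : 0 ≤ multiplier r * y ^ k := by positivity
    have h7 : c₁ * z ≤ α * (2 ^ (-q) * R ^ q) * (multiplier r * y ^ k) := by
      calc c₁ * z = α * (2 ^ (-q) * R ^ q) * ((1 / 2 * R ^ (-(1 / 2) : ℝ)) * y ^ k) := by
            rw [hc₁, hz, h4]; ring
        _ ≤ _ := by gcongr
    have h8 : α * (2 ^ (-q) * R ^ q) * (multiplier r * y ^ k) ≤
        α * (r ^ q + 1) * (multiplier r * y ^ k) := by gcongr
    nlinarith
  -- the absorption term
  have e3 : -(c₁ / 4 * z + B₂) ≤ γ * r ^ s * (multiplier r * y ^ k) := by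
    have h1 : r ^ s * (multiplier r * y ^ k) ≤ z ^ τ' := by
      have h2 : r ^ s ≤ R ^ σ :=
        (Real.rpow_le_rpow hr (by linarith) hs.le).trans
          (Real.rpow_le_rpow_of_exponent_le hR1 (le_max_left _ _))
      have h3 : z ^ τ' = (y ^ k) ^ τ' * (R ^ σ * R ^ (-(1 / 2) : ℝ)) := by
        rw [hz, Real.mul_rpow hyk0 (by positivity), ← Real.rpow_mul hR0.le, hτ'q,
          ← Real.rpow_add hR0]; rfl
      have h4 : y ^ k ≤ (y ^ k) ^ τ' := Real.self_le_rpow_of_le_one hyk0 hyk1 hτ'1.le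
      rw [h3]
      calc _ ≤ R ^ σ * (R ^ (-(1 / 2) : ℝ) * (y ^ k) ^ τ') := by gcongr
        _ = _ := by ring
    have h2 := hB₂ z hz0
    have h3 : |γ * (r ^ s * (multiplier r * y ^ k))| ≤ |γ| * z ^ τ' := by
      rw [abs_mul, abs_of_nonneg (show 0 ≤ r ^ s * (multiplier r * y ^ k) by positivity)]
      gcongr
    have h4 := neg_abs_le (γ * (r ^ s * (multiplier r * y ^ k)))
    linarith [show γ * r ^ s * (multiplier r * y ^ k) = γ * (r ^ s * (multiplier r * y ^ k)) by ring]
  -- the gradient terms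
  have e4 : -(c₁ / 4 * z + B₁) ≤
      -multiplierDeriv r * y ^ k * a ^ p - multiplier r * (a ^ (p - 1) * (C₀ * y ^ (k - 1))) := by
    have h := multiplier_gradient_estimate hp (le_max_left (p - 1) 1) hτ0 hkp hC₀ hr ha hy hy1
    have h5 : z ^ τ = (y ^ k) ^ τ * R ^ (m - 1 / 2) := by
      rw [hz, Real.mul_rpow hyk0 (by positivity), ← Real.rpow_mul hR0.le, hτq]
    rw [← h5, ← hK] at h
    linarith [hB₁ z hz0]
  rw [add_mul]
  linarith


/-! ### Superlinear integral inequalities -/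

/-- A superlinear integral inequality keeps a function above its initial value, if that value is
large. -/
lemma le_of_superlinear_integral_inequality {κ c C M T : ℝ} (hκ : 1 < κ) (hc : 0 < c)
    (hM0 : 0 < M) (hM : C ≤ c * (M / 2) ^ κ) {F : ℝ → ℝ} (hF : ContinuousOn F (Ico 0 T))
    (hF0 : F 0 = M)
    (hint : ∀ a b, 0 ≤ a → a ≤ b → b < T → ∫ t in a..b, (c * F t ^ κ - C) ≤ F b - F a)
    {t : ℝ} (ht : t ∈ Ico 0 T) : M ≤ F t := by
  have hFt : ContinuousOn F (Icc 0 t) := hF.mono fun x hx => ⟨hx.1, hx.2.trans_lt ht.2⟩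
  have hcl : IsClosed ({x | M ≤ F x} ∩ Icc 0 t) := by
    rw [inter_comm]
    exact hFt.preimage_isClosed_of_isClosed isClosed_Icc isClosed_Ici
  -- Continuous induction. From a time where F ≥ M, continuity keeps F above M / 2 for a short
  -- while; there the integrand is nonnegative, so F cannot drop below M.
  have := hcl.Icc_subset_of_forall_exists_gt (a := 0) (b := t) hF0.ge ?_
  · exact this ⟨ht.1, le_rfl⟩
  rintro x ⟨hxM, hx0, hxt⟩ y hy
  have hxM : M ≤ F x := hxM
  have hy : x < y := hy
  have hcont : ContinuousWithinAt F (Icc x t) x :=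
    (hFt x ⟨hx0, hxt.le⟩).mono (Icc_subset_Icc_left hx0)
  have hev : ∀ᶠ z in 𝓝[Icc x t] x, M / 2 < F z :=
    hcont.eventually (lt_mem_nhds (show M / 2 < F x by linarith))
  obtain ⟨δ, hδ, hball⟩ := Metric.mem_nhdsWithin_iff.1 hev
  set z : ℝ := min (x + δ / 2) (min y t) with hz
  have hxz : x < z := lt_min (by linarith) (lt_min hy hxt)
  have hzδ : z ≤ x + δ / 2 := min_le_left _ _
  have hzy : z ≤ y := (min_le_right _ _).trans (min_le_left _ _)
  have hzt : z ≤ t := (min_le_right _ _).trans (min_le_right _ _)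
  refine ⟨z, ?_, hxz, hzy⟩
  have hnn : 0 ≤ ∫ s in x..z, (c * F s ^ κ - C) := by
    refine intervalIntegral.integral_nonneg hxz.le fun s hs => ?_
    have h1 : M / 2 < F s := hball ⟨by
      rw [Metric.mem_ball, Real.dist_eq, abs_of_nonneg (by linarith [hs.1])]
      linarith [hs.2], hs.1, hs.2.trans hzt⟩
    have h2 : (M / 2) ^ κ ≤ F s ^ κ := Real.rpow_le_rpow (by positivity) h1.le (by linarith)
    nlinarith
  have := hint x z hx0 hxz.le (hzt.trans_lt ht.2)
  show M ≤ F z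
  linarith

/-- A function satisfying a superlinear integral inequality blows up, in a time depending only on
its (large) initial value. -/
lemma exists_blowup_of_superlinear {κ c : ℝ} (hκ : 1 < κ) (hc : 0 < c) (C : ℝ) :
    ∃ M₀ : ℝ, ∀ M : ℝ, M₀ ≤ M → ∃ T₁ : ℝ, 0 < T₁ ∧ ∃ f : ℝ → ℝ, Tendsto f (𝓝[<] T₁) atTop ∧
      ∀ T : ℝ, 0 < T → ∀ F : ℝ → ℝ, ContinuousOn F (Ico 0 T) → F 0 = M →
        (∀ a b, 0 ≤ a → a ≤ b → b < T → ∫ t in a..b, (c * F t ^ κ - C) ≤ F b - F a) →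
        T ≤ T₁ ∧ ∀ t ∈ Ico 0 T, f t ≤ F t := by
  have hlim : Tendsto (fun M : ℝ => c / 2 * (M / 2) ^ κ) atTop atTop :=
    ((tendsto_rpow_atTop (by linarith)).comp (tendsto_id.atTop_div_const two_pos)).const_mul_atTop
      (by positivity)
  -- For such M, half of c F^κ already dominates C as long as F ≥ M, leaving F' ≥ (c/2) F^κ in
  -- integrated form.
  obtain ⟨M₀, hM₀⟩ := ((hlim.eventually_ge_atTop |C|).and (eventually_gt_atTop 0)).exists_forall_of_atTop
  refine ⟨M₀, fun M hM => ?_⟩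
  obtain ⟨hMC, hMpos⟩ := hM₀ M hM
  set b : ℝ := (κ - 1) * (c / 2) with hb
  have hκ1 : 0 < κ - 1 := by linarith
  have hb0 : 0 < b := by positivity
  -- The blow-up time of y' = (c/2) y^κ with y(0) = M, whose solution is the lower barrier in the
  -- next line.
  set T₁ : ℝ := M ^ (1 - κ) / b with hT₁
  refine ⟨T₁, by positivity, fun t => (b * (T₁ - t)) ^ (-(1 / (κ - 1))), ?_, ?_⟩
  · have h1 : Tendsto (fun t : ℝ => b * (T₁ - t)) (𝓝[<] T₁) (𝓝[>] 0) := by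
      refine tendsto_nhdsWithin_iff.2 ⟨?_, ?_⟩
      · have : Tendsto (fun t : ℝ => b * (T₁ - t)) (𝓝 T₁) (𝓝 (b * (T₁ - T₁))) :=
          Continuous.tendsto (by fun_prop) _
        rw [sub_self, mul_zero] at this
        exact this.mono_left nhdsWithin_le_nhds
      · filter_upwards [self_mem_nhdsWithin] with t ht
        exact mul_pos hb0 (sub_pos.2 ht)
    exact (tendsto_rpow_neg_nhdsGT_zero (by simpa using hκ1)).comp h1
  intro T hT F hF hF0 hint
  have hCM : C ≤ c * (M / 2) ^ κ := by
    have : 0 ≤ (M / 2) ^ κ := by positivity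
    nlinarith [le_abs_self C]
  have hFM : ∀ t ∈ Ico 0 T, M ≤ F t := fun t ht =>
    le_of_superlinear_integral_inequality hκ hc hMpos hCM hF hF0 hint ht
  have key : ∀ t ∈ Ico 0 T, F t ^ (1 - κ) ≤ b * (T₁ - t) := by
    intro t ht
    have hsub : Icc 0 t ⊆ Ico 0 T := fun x hx => ⟨hx.1, hx.2.trans_lt ht.2⟩
    have hpow : ContinuousOn (fun x => c / 2 * F x ^ κ) (Icc 0 t) :=
      continuousOn_const.mul ((hF.mono hsub).rpow_const fun x hx =>
        Or.inl (by linarith [hFM x (hsub hx)]))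
    -- F is only continuous. Its minorant E is differentiable in the interior, and E' = (c/2) F^κ ≥
    -- (c/2) E^κ, so E^(1-κ) + b x is nonincreasing.
    set E : ℝ → ℝ := fun x => M + ∫ y in (0 : ℝ)..x, c / 2 * F y ^ κ with hE
    have hii : ∀ x ∈ Icc 0 t, IntervalIntegrable (fun x => c / 2 * F x ^ κ) volume 0 x :=
      fun x hx => (hpow.mono (by rw [uIcc_of_le hx.1]; exact Icc_subset_Icc_right hx.2)).intervalIntegrable
    have hEF : ∀ x ∈ Icc 0 t, E x ≤ F x := by
      intro x hx
      have h1 := hint 0 x le_rfl hx.1 (hsub hx).2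
      have h2 : ∫ y in (0 : ℝ)..x, c / 2 * F y ^ κ ≤ ∫ y in (0 : ℝ)..x, (c * F y ^ κ - C) := by
        have hi := hii x hx
        refine intervalIntegral.integral_mono_on hx.1 hi ?_ fun y hy => ?_
        · refine IntervalIntegrable.sub ?_ intervalIntegrable_const
          have := hi.const_mul 2
          refine this.congr (fun y _ => ?_)
          ring
        · have hy' := hFM y ⟨hy.1, (hy.2.trans hx.2).trans_lt ht.2⟩
          have h3 : (M / 2) ^ κ ≤ F y ^ κ :=
            Real.rpow_le_rpow (by positivity) (by linarith) (by linarith)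
          nlinarith [le_abs_self C]
      simp only [hE]
      linarith
    have hEM : ∀ x ∈ Icc 0 t, M ≤ E x := by
      intro x hx
      have : 0 ≤ ∫ y in (0 : ℝ)..x, c / 2 * F y ^ κ :=
        intervalIntegral.integral_nonneg hx.1 fun y hy => by
          have := hFM y ⟨hy.1, (hy.2.trans hx.2).trans_lt ht.2⟩
          have : 0 < F y := by linarith
          positivity
      simp only [hE]; linarith
    have hEc : ContinuousOn E (Icc 0 t) := by
      refine continuousOn_const.add ?_
      have := intervalIntegral.continuousOn_primitive_interval' (hii t ⟨ht.1, le_rfl⟩) left_mem_uIcc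
      rwa [uIcc_of_le ht.1] at this
    have hEd : ∀ x ∈ Ioo 0 t, HasDerivAt E (c / 2 * F x ^ κ) x := by
      intro x hx
      refine HasDerivAt.const_add _ ?_
      have hnb : Icc 0 t ∈ 𝓝 x := Icc_mem_nhds hx.1 hx.2
      exact intervalIntegral.integral_hasDerivAt_right (hii x (Ioo_subset_Icc_self hx))
        (hpow.stronglyMeasurableAtFilter_nhdsWithin measurableSet_Icc x |>.filter_mono
          (by rw [nhdsWithin_eq_nhds.2 hnb])) (hpow.continuousAt hnb)
    have hGd : ∀ x ∈ Ioo 0 t, HasDerivAt (fun x => E x ^ (1 - κ) + b * x)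
        (c / 2 * F x ^ κ * (1 - κ) * E x ^ (1 - κ - 1) + b) x := by
      intro x hx
      have h1 := (hEd x hx).rpow_const (p := 1 - κ)
        (Or.inl (by linarith [hEM x (Ioo_subset_Icc_self hx)]))
      exact h1.add (((hasDerivAt_id x).const_mul b).congr_deriv (mul_one b))
    have hanti : AntitoneOn (fun x => E x ^ (1 - κ) + b * x) (Icc 0 t) := by
      refine antitoneOn_of_deriv_nonpos (convex_Icc 0 t) ?_ ?_ ?_
      · exact (hEc.rpow_const fun x hx => Or.inl (by linarith [hEM x hx])).add
          (continuousOn_const.mul continuousOn_id)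
      · intro x hx
        rw [interior_Icc] at hx
        exact (hGd x hx).differentiableAt.differentiableWithinAt
      · intro x hx
        rw [interior_Icc] at hx
        rw [(hGd x hx).deriv]
        have hxI := Ioo_subset_Icc_self hx
        have hE0 : 0 < E x := by linarith [hEM x hxI]
        have h1 : E x ^ κ ≤ F x ^ κ := Real.rpow_le_rpow hE0.le (hEF x hxI) (by linarith)
        have h2 : E x ^ κ * E x ^ (1 - κ - 1) = 1 := by
          rw [← Real.rpow_add hE0]; simp
        have h3 : 1 ≤ F x ^ κ * E x ^ (1 - κ - 1) :=
          h2.symm.trans_le (mul_le_mul_of_nonneg_right h1 (by positivity))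
        have : c / 2 * F x ^ κ * (1 - κ) * E x ^ (1 - κ - 1) + b =
          -(b * (F x ^ κ * E x ^ (1 - κ - 1) - 1)) := by rw [hb]; ring
        rw [this]
        nlinarith
    have h1 := hanti ⟨le_rfl, ht.1⟩ ⟨ht.1, le_rfl⟩ ht.1
    have hE0 : E 0 = M := by simp [hE]
    simp only [hE0, mul_zero, add_zero] at h1
    have h2 : F t ^ (1 - κ) ≤ E t ^ (1 - κ) :=
      Real.rpow_le_rpow_of_nonpos (by linarith [hEM t ⟨ht.1, le_rfl⟩]) (hEF t ⟨ht.1, le_rfl⟩)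
        (by linarith)
    have h3 : b * T₁ = M ^ (1 - κ) := mul_div_cancel₀ _ hb0.ne'
    linarith [mul_sub b T₁ t]
  have hlt : ∀ t ∈ Ico 0 T, 0 < b * (T₁ - t) := fun t ht =>
    lt_of_lt_of_le (Real.rpow_pos_of_pos (hMpos.trans_le (hFM t ht)) _) (key t ht)
  refine ⟨?_, fun t ht => ?_⟩
  -- Were T₁ < T, the positive quantity F(T₁)^(1-κ) would be bounded by b (T₁ - T₁) = 0.
  · by_contra! h
    have hT₁0 : 0 < T₁ := by positivity
    have := hlt T₁ ⟨hT₁0.le, h⟩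
    simp at this
  · have hF0 : 0 < F t := hMpos.trans_le (hFM t ht)
    have h1 := Real.rpow_le_rpow_of_nonpos (z := -(1 / (κ - 1))) (Real.rpow_pos_of_pos hF0 _)
      (key t ht) (by simp [hκ1.le])
    rw [← Real.rpow_mul hF0.le, show (1 - κ) * -(1 / (κ - 1)) = 1 by field_simp; ring,
      Real.rpow_one] at h1
    exact h1


/-! ### The chain rule for absolutely continuous functions -/

lemma LipschitzWith.comp_absolutelyContinuousOnInterval {Φ f : ℝ → ℝ} {K : NNReal} {a b : ℝ}
    (hΦ : LipschitzWith K Φ) (hf : AbsolutelyContinuousOnInterval f a b) :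
    AbsolutelyContinuousOnInterval (Φ ∘ f) a b := by
  rw [absolutelyContinuousOnInterval_iff] at hf ⊢
  intro ε hε
  obtain ⟨δ, hδ, h⟩ := hf (ε / (K + 1)) (by positivity)
  refine ⟨δ, hδ, fun E hE hEδ => ?_⟩
  have h1 := h E hE hEδ
  calc ∑ i ∈ Finset.range E.1, dist ((Φ ∘ f) (E.2 i).1) ((Φ ∘ f) (E.2 i).2)
      ≤ ∑ i ∈ Finset.range E.1, K * dist (f (E.2 i).1) (f (E.2 i).2) :=
        Finset.sum_le_sum fun i _ => hΦ.dist_le_mul _ _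
    _ = K * ∑ i ∈ Finset.range E.1, dist (f (E.2 i).1) (f (E.2 i).2) := by rw [Finset.mul_sum]
    _ ≤ K * (ε / (K + 1)) := by gcongr
    _ < (K + 1) * (ε / (K + 1)) := by gcongr; linarith
    _ = ε := by field_simp

/-- The chain rule for a Lipschitz function of a primitive. -/
lemma integral_comp_mul_eq_sub_of_primitive {Φ H f w : ℝ → ℝ} {K : NNReal} {a b : ℝ} (hab : a ≤ b)
    (hw : IntervalIntegrable w volume a b) (hf : ∀ t ∈ Icc a b, f t = f a + ∫ s in a..t, w s)
    (hΦ : ∀ y, HasDerivAt Φ (H y) y) (hL : LipschitzWith K Φ) :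
    ∫ t in a..b, H (f t) * w t = Φ (f b) - Φ (f a) := by
  -- `f` is known to be a primitive only on [a, b]; `g` is that primitive on the whole line, so that
  -- it can be differentiated almost everywhere and composed with `Φ`.
  set g : ℝ → ℝ := fun t => f a + ∫ s in a..t, w s with hg
  have hgAC : AbsolutelyContinuousOnInterval g a b :=
    (LipschitzOnWith.absolutelyContinuousOnInterval (K := 0) (f := fun _ => f a)
      (LipschitzWith.const (f a)).lipschitzOnWith).add
      (hw.absolutelyContinuousOnInterval_intervalIntegral left_mem_uIcc)
  have h := (hL.comp_absolutelyContinuousOnInterval hgAC).integral_deriv_eq_sub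
  rw [Function.comp_apply, Function.comp_apply, show g b = f b from (hf b ⟨hab, le_rfl⟩).symm,
    show g a = f a from (hf a ⟨le_rfl, hab⟩).symm] at h
  rw [← h]
  refine intervalIntegral.integral_congr_ae ?_
  filter_upwards [hw.ae_hasDerivAt_integral] with t ht htm
  have htI := uIoc_subset_uIcc htm
  have h1 := ((ht htI a left_mem_uIcc).const_add (f a))
  have h2 := (hΦ (g t)).comp t h1
  rw [uIcc_of_le hab] at htI
  rw [h2.deriv, hf t htI]

/-! ### Smooth time cutoffs -/

/-- A smooth function increasing from `0` to `1` on `[c, c + 1 / (n + 1)]`. -/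
def smoothStep (n : ℕ) (c t : ℝ) : ℝ := Real.smoothTransition ((n + 1) * (t - c))

lemma contDiff_smoothStep (n : ℕ) (c : ℝ) : ContDiff ℝ ∞ (smoothStep n c) := by
  unfold smoothStep
  exact Real.smoothTransition.contDiff.comp (by fun_prop)

lemma smoothStep_eq_zero {n : ℕ} {c t : ℝ} (h : t ≤ c) : smoothStep n c t = 0 :=
  Real.smoothTransition.zero_of_nonpos (mul_nonpos_of_nonneg_of_nonpos (by positivity) (by linarith))

lemma smoothStep_eq_one {n : ℕ} {c t : ℝ} (h : c + 1 / (n + 1) ≤ t) : smoothStep n c t = 1 := by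
  refine Real.smoothTransition.one_of_one_le ?_
  have h0 : (0 : ℝ) < n + 1 := by positivity
  have : 1 / ((n : ℝ) + 1) ≤ t - c := by linarith
  rwa [div_le_iff₀' h0] at this

lemma monotone_smoothStep (n : ℕ) (c : ℝ) : Monotone (smoothStep n c) := fun _ _ h =>
  Real.smoothTransition.monotone (by gcongr)

lemma deriv_smoothStep_eq_zero {n : ℕ} {c t : ℝ} (h : t < c ∨ c + 1 / (n + 1) < t) :
    deriv (smoothStep n c) t = 0 := by
  rcases h with h | h
  · have : smoothStep n c =ᶠ[𝓝 t] fun _ => 0 := by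
      filter_upwards [gt_mem_nhds h] with s hs using smoothStep_eq_zero (le_of_lt hs)
    rw [this.deriv_eq]; simp
  · have : smoothStep n c =ᶠ[𝓝 t] fun _ => 1 := by
      filter_upwards [lt_mem_nhds h] with s hs using smoothStep_eq_one (le_of_lt hs)
    rw [this.deriv_eq]; simp

lemma eventually_one_div_add_one_lt {ε : ℝ} (hε : 0 < ε) : ∀ᶠ n : ℕ in atTop, 1 / ((n : ℝ) + 1) < ε :=
  tendsto_one_div_add_atTop_nhds_zero_nat.eventually (gt_mem_nhds hε)

lemma tendsto_smoothStep (c t : ℝ) :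
    Tendsto (fun n => smoothStep n c t) atTop (𝓝 ((Ioi c).indicator (fun _ => 1) t)) := by
  by_cases h : c < t
  · rw [indicator_of_mem (by exact h)]
    refine tendsto_const_nhds.congr' ?_
    filter_upwards [eventually_one_div_add_one_lt (sub_pos.2 h)] with n hn
    exact (smoothStep_eq_one (by linarith)).symm
  · rw [indicator_of_notMem (by exact h)]
    simp only [smoothStep_eq_zero (not_lt.1 h)]
    exact tendsto_const_nhds

/-- The derivatives of the steps form an approximate identity at c: they are nonnegative,
concentrate on [c, c + 1/(n+1)] and have total mass 1. -/
lemma tendsto_integral_deriv_smoothStep_mul {U : ℝ → ℝ} {T c : ℝ} (hc : c ∈ Ioo 0 T)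
    (hU : IntegrableOn U (Ioo 0 T)) (hUc : ContinuousAt U c) :
    Tendsto (fun n => ∫ t in Ioo 0 T, deriv (smoothStep n c) t * U t) atTop (𝓝 (U c)) := by
  obtain ⟨hc0, hcT⟩ := hc
  have hcont : ∀ n, Continuous (deriv (smoothStep n c)) := fun n =>
    (contDiff_smoothStep n c).continuous_deriv (by norm_cast)
  -- The window is a neighbourhood of c inside (0, T); it captures the full mass as soon as 1/(n+1)
  -- < (T - c)/2.
  refine tendsto_setIntegral_peak_smul_of_integrableOn_of_tendsto (t := Ioc (c / 2) ((c + T) / 2))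
    measurableSet_Ioo measurableSet_Ioc ?_ ?_ ?_ ?_ ?_ ?_ ?_ hU (hUc.tendsto.mono_left nhdsWithin_le_nhds)
  · exact fun t ht => ⟨by linarith [ht.1], by linarith [ht.2]⟩
  · exact mem_nhdsWithin_of_mem_nhds (Ioc_mem_nhds (by linarith) (by linarith))
  · simp
  · exact Eventually.of_forall fun n t _ => (monotone_smoothStep n c).deriv_nonneg
  · intro u hu hcu
    obtain ⟨ε, hε, hball⟩ := Metric.isOpen_iff.1 hu c hcu
    refine Metric.tendstoUniformlyOn_iff.2 fun δ hδ => ?_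
    filter_upwards [eventually_one_div_add_one_lt hε] with n hn t ht
    have : deriv (smoothStep n c) t = 0 := by
      refine deriv_smoothStep_eq_zero ?_
      by_contra! h
      refine ht.2 (hball ?_)
      rw [Metric.mem_ball, Real.dist_eq, abs_lt]
      constructor <;> linarith [h.1, h.2]
    simpa [this] using hδ
  · refine tendsto_const_nhds.congr' ?_
    filter_upwards [eventually_one_div_add_one_lt (show 0 < (T - c) / 2 by linarith)] with n hn
    rw [← intervalIntegral.integral_of_le (by linarith), intervalIntegral.integral_deriv_eq_sub
      (fun t _ => (contDiff_smoothStep n c).differentiable (by simp) t)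
      ((hcont n).intervalIntegrable _ _), smoothStep_eq_one (by linarith),
      smoothStep_eq_zero (by linarith), sub_zero]
  · exact Eventually.of_forall fun n => (hcont n).aestronglyMeasurable

lemma abs_smoothStep_sub_le_one (n : ℕ) (a b t : ℝ) : |smoothStep n a t - smoothStep n b t| ≤ 1 := by
  have h1 := Real.smoothTransition.nonneg ((n + 1) * (t - a))
  have h2 := Real.smoothTransition.le_one ((n + 1) * (t - a))
  have h3 := Real.smoothTransition.nonneg ((n + 1) * (t - b))
  have h4 := Real.smoothTransition.le_one ((n + 1) * (t - b))
  rw [abs_le]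
  simp only [smoothStep]
  constructor <;> linarith

/-- Dominated convergence, since differences of steps are bounded by 1. Each step vanishes at its
own starting point, so the limit is the indicator of (a, b]. -/
lemma tendsto_integral_mul_smoothStep_sub {X : Type*} [MeasurableSpace X] {μ : Measure (ℝ × X)}
    {Z : ℝ × X → ℝ} (hZ : Integrable Z μ) {a b : ℝ} (hab : a ≤ b) :
    Tendsto (fun n => ∫ z, Z z * (smoothStep n a z.1 - smoothStep n b z.1) ∂μ) atTop
      (𝓝 (∫ z, Z z * (Ioc a b).indicator (fun _ => (1 : ℝ)) z.1 ∂μ)) := by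
  refine tendsto_integral_of_dominated_convergence (fun z => |Z z|) (fun n => ?_)
    hZ.abs (fun n => Eventually.of_forall fun z => ?_) (Eventually.of_forall fun z => ?_)
  · have hc : Measurable fun t => smoothStep n a t - smoothStep n b t :=
      ((contDiff_smoothStep n a).sub (contDiff_smoothStep n b)).continuous.measurable
    exact hZ.aestronglyMeasurable.mul (hc.comp measurable_fst).aestronglyMeasurable
  · rw [Real.norm_eq_abs, abs_mul]
    exact mul_le_of_le_one_right (abs_nonneg _) (abs_smoothStep_sub_le_one n a b z.1)
  · refine Tendsto.const_mul _ ?_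
    have := (tendsto_smoothStep a z.1).sub (tendsto_smoothStep b z.1)
    convert this using 2
    rw [← Ioi_sdiff_Ioi, indicator_sdiff (Ioi_subset_Ioi hab)]
    rfl

lemma integrable_mul_indicator_Ioc {X : Type*} [MeasurableSpace X] {μ : Measure (ℝ × X)}
    {Z : ℝ × X → ℝ} (hZ : Integrable Z μ) (a b : ℝ) :
    Integrable (fun z => Z z * (Ioc a b).indicator (fun _ => (1 : ℝ)) z.1) μ := by
  refine hZ.mul_bdd (c := 1) ?_ (Eventually.of_forall fun z => ?_)
  · exact ((measurable_const.indicator measurableSet_Ioc).comp measurable_fst).aestronglyMeasurable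
  · by_cases hz : z.1 ∈ Ioc a b <;> simp [hz]

/-! ### Continuity of localized functionals -/

section Localized

variable {N : ℕ} {Ω : Set (EuclideanSpace ℝ (Fin N))} {u : ℝ → EuclideanSpace ℝ (Fin N) → ℝ}
  {ρ : EuclideanSpace ℝ (Fin N) → ℝ} {I : Set ℝ}

/-- Continuity of u is available only over the closure of Ω. Inside Ω this suffices, and off the
support of ρ the product vanishes locally, so the continuity extends to all x. -/
lemma continuousOn_comp_mul (hΩ : IsOpen Ω)
    (hu : ContinuousOn (fun z : ℝ × EuclideanSpace ℝ (Fin N) => u z.1 z.2) (I ×ˢ closure Ω))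
    {Φ : ℝ → ℝ} (hΦ : Continuous Φ) (hρ : Continuous ρ) (hρΩ : tsupport ρ ⊆ Ω) :
    ContinuousOn (fun z : ℝ × EuclideanSpace ℝ (Fin N) => Φ (u z.1 z.2) * ρ z.2) (I ×ˢ univ) := by
  rintro ⟨t, x⟩ ⟨ht, -⟩
  by_cases hx : x ∈ Ω
  · have h1 := hu (t, x) ⟨ht, subset_closure hx⟩
    have h2 : I ×ˢ closure Ω ∈ 𝓝[I ×ˢ univ] (t, x) := by
      have : (univ : Set ℝ) ×ˢ Ω ∈ 𝓝 (t, x) := (isOpen_univ.prod hΩ).mem_nhds ⟨trivial, hx⟩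
      filter_upwards [self_mem_nhdsWithin, mem_nhdsWithin_of_mem_nhds this] with z hz hz'
      exact ⟨hz.1, subset_closure hz'.2⟩
    exact (hΦ.continuousAt.comp_continuousWithinAt (h1.mono_of_mem_nhdsWithin h2)).mul
      (hρ.comp continuous_snd).continuousWithinAt
  · have hx' : x ∉ tsupport ρ := fun h => hx (hρΩ h)
    have h1 : (univ : Set ℝ) ×ˢ (tsupport ρ)ᶜ ∈ 𝓝 (t, x) :=
      (isOpen_univ.prod (isClosed_tsupport ρ).isOpen_compl).mem_nhds ⟨trivial, hx'⟩
    have h2 : (fun z : ℝ × EuclideanSpace ℝ (Fin N) => Φ (u z.1 z.2) * ρ z.2) =ᶠ[𝓝 (t, x)]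
        fun _ => 0 := by
      filter_upwards [h1] with z hz
      rw [image_eq_zero_of_notMem_tsupport hz.2, mul_zero]
    exact (continuousAt_const.congr h2.symm).continuousWithinAt

lemma continuousOn_integral_comp_mul (hΩ : IsOpen Ω)
    (hu : ContinuousOn (fun z : ℝ × EuclideanSpace ℝ (Fin N) => u z.1 z.2) (I ×ˢ closure Ω))
    {Φ : ℝ → ℝ} (hΦ : Continuous Φ) (hρ : Continuous ρ) (hρc : HasCompactSupport ρ)
    (hρΩ : tsupport ρ ⊆ Ω) :
    ContinuousOn (fun t => ∫ x in Ω, Φ (u t x) * ρ x) I :=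
  continuousOn_integral_of_compact_support hρc (continuousOn_comp_mul hΩ hu hΦ hρ hρΩ)
    fun t x _ hx => by rw [image_eq_zero_of_notMem_tsupport hx, mul_zero]

end Localized

/-! ### From the distributional time derivative to time increments -/

namespace StratifiedGroup

variable {N : ℕ} {Ω : Set (EuclideanSpace ℝ (Fin N))} {T : ℝ}

lemma cylMeasure_eq_prod (T : ℝ) (Ω : Set (EuclideanSpace ℝ (Fin N))) :
    cylMeasure T Ω = (volume.restrict (Ioo 0 T)).prod (volume.restrict Ω) := by
  rw [cylMeasure, Measure.volume_eq_prod, Measure.prod_restrict]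

lemma isFiniteMeasure_restrict (hΩb : Bornology.IsBounded Ω) :
    IsFiniteMeasure (volume.restrict Ω) := ⟨by simpa using hΩb.measure_lt_top⟩

lemma isFiniteMeasure_cylMeasure (hΩb : Bornology.IsBounded Ω) :
    IsFiniteMeasure (cylMeasure T Ω) := by
  have := isFiniteMeasure_restrict hΩb
  rw [cylMeasure_eq_prod]
  infer_instance

variable {u w : ℝ → EuclideanSpace ℝ (Fin N) → ℝ}

/-- The time derivative in the sense of distributions, integrated against a spatial weight. -/
lemma IsTimeDeriv.integral_sub_mul (hΩ : IsOpen Ω) (hΩb : Bornology.IsBounded Ω)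
    (hu : ContinuousOn (fun z : ℝ × EuclideanSpace ℝ (Fin N) => u z.1 z.2) (Ico 0 T ×ˢ closure Ω))
    (hui : Integrable (fun z : ℝ × EuclideanSpace ℝ (Fin N) => u z.1 z.2) (cylMeasure T Ω))
    (hw : IsTimeDeriv T Ω u w) {a b : ℝ} (ha : a ∈ Ioo 0 T) (hb : b ∈ Ioo 0 T) (hab : a ≤ b)
    {ρ : EuclideanSpace ℝ (Fin N) → ℝ} (hρ : ContDiff ℝ ∞ ρ) (hρc : HasCompactSupport ρ)
    (hρΩ : tsupport ρ ⊆ Ω) :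
    (∫ x in Ω, u b x * ρ x) - ∫ x in Ω, u a x * ρ x =
      ∫ x in Ω, (∫ t in a..b, w t x) * ρ x := by
  have := isFiniteMeasure_restrict hΩb
  have := isFiniteMeasure_cylMeasure (T := T) hΩb
  have hwi : Integrable (fun z : ℝ × EuclideanSpace ℝ (Fin N) => w z.1 z.2) (cylMeasure T Ω) :=
    hw.1.integrable (by norm_num)
  obtain ⟨B, hB⟩ := hρ.continuous.bounded_above_of_compact_support hρc
  have hρz : AEStronglyMeasurable (fun z : ℝ × EuclideanSpace ℝ (Fin N) => ρ z.2)
    (cylMeasure T Ω) := (hρ.continuous.comp continuous_snd).aestronglyMeasurable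
  have huρ := hui.mul_bdd (c := B) hρz (Eventually.of_forall fun z => hB z.2)
  have hwρ := hwi.mul_bdd (c := B) hρz (Eventually.of_forall fun z => hB z.2)
  set U : ℝ → ℝ := fun t => ∫ x in Ω, u t x * ρ x with hU
  have hUi : IntegrableOn U (Ioo 0 T) := by
    rw [cylMeasure_eq_prod] at huρ
    exact huρ.integral_prod_left
  have hUc : ContinuousOn U (Ico 0 T) :=
    continuousOn_integral_comp_mul hΩ hu continuous_id hρ.continuous hρc hρΩ
  have hUat : ∀ t ∈ Ioo 0 T, ContinuousAt U t := fun t ht =>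
    hUc.continuousAt (Ico_mem_nhds ht.1 ht.2)
  -- The test functions are A_n(t) ρ(x), with A_n tending to the indicator of (a, b] and its
  -- derivative tending to the difference of the point masses at a and b.
  set A : ℕ → ℝ → ℝ := fun n t => smoothStep n a t - smoothStep n b t with hA
  have hAs : ∀ n, ContDiff ℝ ∞ (A n) := fun n =>
    (contDiff_smoothStep n a).sub (contDiff_smoothStep n b)
  have hAd : ∀ n t, deriv (A n) t = deriv (smoothStep n a) t - deriv (smoothStep n b) t :=
    fun n t => deriv_fun_sub ((contDiff_smoothStep n a).differentiable (by simp) t)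
      ((contDiff_smoothStep n b).differentiable (by simp) t)
  have hdi : ∀ n c, Integrable (fun t => deriv (smoothStep n c) t * U t)
      (volume.restrict (Ioo 0 T)) := by
    intro n c
    have hcont : Continuous (deriv (smoothStep n c)) :=
      (contDiff_smoothStep n c).continuous_deriv (by norm_cast)
    obtain ⟨D, hD⟩ := (isCompact_Icc (a := c) (b := c + 1 / (n + 1))).exists_bound_of_continuousOn
      hcont.continuousOn
    refine hUi.bdd_mul (c := max D 0) hcont.aestronglyMeasurable (Eventually.of_forall fun t => ?_)
    by_cases ht : t ∈ Icc c (c + 1 / (n + 1))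
    · exact (hD t ht).trans (le_max_left _ _)
    · rw [deriv_smoothStep_eq_zero (by by_contra! h; exact ht h)]
      simp
  -- the left-hand side of the weak formulation
  have hlhs : Tendsto (fun n => ∫ t in Ioo 0 T, deriv (A n) t * U t) atTop (𝓝 (U a - U b)) := by
    refine ((tendsto_integral_deriv_smoothStep_mul ha hUi (hUat a ha)).sub
      (tendsto_integral_deriv_smoothStep_mul hb hUi (hUat b hb))).congr fun n => ?_
    rw [← integral_sub (hdi n a) (hdi n b)]
    simp only [hAd, sub_mul]
  -- the right-hand side
  have hrhs : Tendsto (fun n => ∫ z, w z.1 z.2 * ρ z.2 * A n z.1 ∂(cylMeasure T Ω)) atTop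
      (𝓝 (∫ z, w z.1 z.2 * ρ z.2 * (Ioc a b).indicator (fun _ => (1 : ℝ)) z.1
        ∂(cylMeasure T Ω))) :=
    tendsto_integral_mul_smoothStep_sub hwρ hab
  have heq : ∀ᶠ n in atTop, ∫ t in Ioo 0 T, deriv (A n) t * U t =
      -∫ z, w z.1 z.2 * ρ z.2 * A n z.1 ∂(cylMeasure T Ω) := by
    -- For b + 1/(n+1) < T the time support of A_n is compact in (0, T), as the definition of the
    -- distributional derivative requires.
    filter_upwards [eventually_one_div_add_one_lt (sub_pos.2 hb.2)] with n hn
    set η : ℝ × EuclideanSpace ℝ (Fin N) → ℝ := fun z => A n z.1 * ρ z.2 with hη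
    have hηs : ContDiff ℝ ∞ η := ((hAs n).comp contDiff_fst).mul (hρ.comp contDiff_snd)
    have hsub : Function.support η ⊆ Icc a (b + 1 / (n + 1)) ×ˢ tsupport ρ := by
      intro z hz
      have h1 : A n z.1 ≠ 0 := left_ne_zero_of_mul hz
      refine ⟨?_, subset_tsupport _ (right_ne_zero_of_mul hz)⟩
      by_contra h
      refine h1 ?_
      simp only [mem_Icc, not_and_or, not_le] at h
      rcases h with h | h
      · simp [hA, smoothStep_eq_zero h.le, smoothStep_eq_zero (h.le.trans hab)]
      · simp only [hA]
        rw [smoothStep_eq_one h.le, smoothStep_eq_one (by linarith), sub_self]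
    have hK : IsCompact (Icc a (b + 1 / ((n : ℝ) + 1)) ×ˢ tsupport ρ) := isCompact_Icc.prod hρc
    have hts : tsupport η ⊆ Icc a (b + 1 / (n + 1)) ×ˢ tsupport ρ :=
      closure_minimal hsub hK.isClosed
    have h := hw.2 η hηs (hK.of_isClosed_subset (isClosed_tsupport η) hts) (hts.trans
      (prod_mono (fun t ht => ⟨ha.1.trans_le ht.1, by linarith [ht.2]⟩) hρΩ))
    have hfd : ∀ z, fderiv ℝ η z (1, 0) = deriv (A n) z.1 * ρ z.2 := by
      intro z
      have h1 : HasFDerivAt (fun z : ℝ × EuclideanSpace ℝ (Fin N) => A n z.1)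
          ((ContinuousLinearMap.toSpanSingleton ℝ (deriv (A n) z.1)).comp
            (ContinuousLinearMap.fst ℝ ℝ _)) z :=
        ((hAs n).differentiable (by simp) z.1).hasDerivAt.hasFDerivAt.comp z hasFDerivAt_fst
      have h2 : HasFDerivAt (fun z : ℝ × EuclideanSpace ℝ (Fin N) => ρ z.2)
          ((fderiv ℝ ρ z.2).comp (ContinuousLinearMap.snd ℝ ℝ _)) z :=
        (hρ.differentiable (by simp) z.2).hasFDerivAt.comp z hasFDerivAt_snd
      rw [show fderiv ℝ η z = _ from (h1.mul h2).fderiv]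
      simp
      ring
    simp only [hfd] at h
    have h3 : ∫ z, u z.1 z.2 * (deriv (A n) z.1 * ρ z.2) ∂(cylMeasure T Ω) =
        ∫ t in Ioo 0 T, deriv (A n) t * U t := by
      have hint : Integrable (fun z : ℝ × EuclideanSpace ℝ (Fin N) =>
          u z.1 z.2 * (deriv (A n) z.1 * ρ z.2)) (cylMeasure T Ω) := by
        obtain ⟨D, hD⟩ := ((hηs.continuous_fderiv (by simp)).clm_apply
          (continuous_const (y := ((1 : ℝ), (0 : EuclideanSpace ℝ (Fin N)))))).bounded_above_of_compact_support
          (HasCompactSupport.fderiv_apply ℝ (hK.of_isClosed_subset (isClosed_tsupport η) hts) (1, 0))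
        simp only [hfd] at hD
        have hc : Continuous (deriv (A n)) := (hAs n).continuous_deriv (by norm_cast)
        exact hui.mul_bdd (c := D) ((hc.comp continuous_fst).mul
          (hρ.continuous.comp continuous_snd)).aestronglyMeasurable (Eventually.of_forall hD)
      rw [cylMeasure_eq_prod] at hint ⊢
      rw [integral_prod _ hint]
      refine integral_congr_ae (Eventually.of_forall fun t => ?_)
      simp only [hU]
      rw [← integral_const_mul]
      refine integral_congr_ae (Eventually.of_forall fun x => ?_)
      simp only
      ring
    rw [h3] at h
    rw [h]
    congr 1
    refine integral_congr_ae (Eventually.of_forall fun z => ?_)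
    simp only [hη]
    ring
  have hlim := tendsto_nhds_unique (hlhs.congr' heq) hrhs.neg
  have hfin : ∫ z, w z.1 z.2 * ρ z.2 * (Ioc a b).indicator (fun _ => (1 : ℝ)) z.1
      ∂(cylMeasure T Ω) = ∫ x in Ω, (∫ t in a..b, w t x) * ρ x := by
    have hint : Integrable (fun z : ℝ × EuclideanSpace ℝ (Fin N) =>
        w z.1 z.2 * ρ z.2 * (Ioc a b).indicator (fun _ => (1 : ℝ)) z.1) (cylMeasure T Ω) :=
      integrable_mul_indicator_Ioc hwρ a b
    rw [cylMeasure_eq_prod] at hint ⊢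
    rw [integral_prod_symm _ hint]
    refine integral_congr_ae (Eventually.of_forall fun x => ?_)
    simp only
    rw [intervalIntegral.integral_of_le hab, ← integral_mul_const]
    have hsub : Ioc a b ⊆ Ioo 0 T := fun t ht => ⟨ha.1.trans ht.1, ht.2.trans_lt hb.2⟩
    have : ∀ t, w t x * ρ x * (Ioc a b).indicator (fun _ => (1 : ℝ)) t =
        (Ioc a b).indicator (fun t => w t x * ρ x) t := fun t => by
      by_cases ht : t ∈ Ioc a b <;> simp [ht]
    simp only [this]
    rw [setIntegral_indicator measurableSet_Ioc, inter_eq_self_of_subset_right hsub]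
  rw [hfin] at hlim
  simp only [hU] at hlim
  linarith

end StratifiedGroup


namespace StratifiedGroup

variable {N : ℕ} {Ω : Set (EuclideanSpace ℝ (Fin N))} {T : ℝ}
  {u w : ℝ → EuclideanSpace ℝ (Fin N) → ℝ}

/-- For a single pair of times, the increment of `u` is the integral of its time derivative. -/
lemma IsTimeDeriv.ae_sub_eq_integral (hΩ : IsOpen Ω) (hΩb : Bornology.IsBounded Ω)
    (hu : ContinuousOn (fun z : ℝ × EuclideanSpace ℝ (Fin N) => u z.1 z.2) (Ico 0 T ×ˢ closure Ω))
    (hui : Integrable (fun z : ℝ × EuclideanSpace ℝ (Fin N) => u z.1 z.2) (cylMeasure T Ω))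
    (hw : IsTimeDeriv T Ω u w) {a b : ℝ} (ha : a ∈ Ioo 0 T) (hb : b ∈ Ioo 0 T) (hab : a ≤ b) :
    ∀ᵐ x ∂(volume.restrict Ω), u b x - u a x = ∫ t in a..b, w t x := by
  have := isFiniteMeasure_restrict hΩb
  have := isFiniteMeasure_cylMeasure (T := T) hΩb
  have hwi : Integrable (fun z : ℝ × EuclideanSpace ℝ (Fin N) => w z.1 z.2) (cylMeasure T Ω) :=
    hw.1.integrable (by norm_num)
  have hui' : ∀ t ∈ Ioo 0 T, IntegrableOn (u t) Ω := fun t ht => by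
    have h1 : ContinuousOn (u t) (closure Ω) :=
      hu.comp (f := fun x => (t, x)) (by fun_prop) fun x hx => ⟨⟨ht.1.le, ht.2⟩, hx⟩
    exact (h1.integrableOn_compact hΩb.isCompact_closure).mono_set subset_closure
  have hWi : IntegrableOn (fun x => ∫ t in a..b, w t x) Ω := by
    simp only [intervalIntegral.integral_of_le hab]
    have hsub : Ioc a b ⊆ Ioo 0 T := fun t ht => ⟨ha.1.trans ht.1, ht.2.trans_lt hb.2⟩
    have h1 : Integrable (fun z : ℝ × EuclideanSpace ℝ (Fin N) => w z.1 z.2)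
        ((volume.restrict (Ioc a b)).prod (volume.restrict Ω)) := by
      rw [cylMeasure_eq_prod] at hwi
      exact hwi.mono_measure (Measure.prod_mono (Measure.restrict_mono hsub le_rfl) le_rfl)
    exact h1.integral_prod_right
  -- The fundamental lemma of the calculus of variations turns the identity for all weights ρ into
  -- one for almost every x.
  have key := hΩ.ae_eq_zero_of_integral_contDiff_smul_eq_zero (μ := volume)
    (f := fun x => u b x - u a x - ∫ t in a..b, w t x)
    (((hui' b hb).sub (hui' a ha)).sub hWi).locallyIntegrableOn ?_
  · rw [ae_restrict_iff' hΩ.measurableSet]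
    filter_upwards [key] with x hx hxΩ using sub_eq_zero.1 (hx hxΩ)
  intro ρ hρ hρc hρΩ
  obtain ⟨B, hB⟩ := hρ.continuous.bounded_above_of_compact_support hρc
  have hb' : ∀ v : EuclideanSpace ℝ (Fin N) → ℝ, IntegrableOn v Ω →
      Integrable (fun x => v x * ρ x) (volume.restrict Ω) := fun v hv =>
    hv.mul_bdd hρ.continuous.aestronglyMeasurable (Eventually.of_forall hB)
  have h := hw.integral_sub_mul hΩ hΩb hu hui ha hb hab hρ hρc hρΩ
  have h0 : ∫ x in Ω, ((u b x * ρ x - u a x * ρ x) - (∫ t in a..b, w t x) * ρ x) = 0 := by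
    rw [integral_sub (f := fun x => u b x * ρ x - u a x * ρ x)
      ((hb' _ (hui' b hb)).sub (hb' _ (hui' a ha))) (hb' _ hWi),
      integral_sub (hb' _ (hui' b hb)) (hb' _ (hui' a ha)), h, sub_self]
  rw [← setIntegral_eq_integral_of_forall_compl_eq_zero (s := Ω), ← h0]
  · refine integral_congr_ae (Eventually.of_forall fun x => ?_)
    simp only [smul_eq_mul]
    ring
  · intro x hx
    rw [image_eq_zero_of_notMem_tsupport fun h => hx (hρΩ h), zero_smul]

/-- Almost every time slice is a primitive of the time derivative. -/
lemma IsTimeDeriv.ae_eq_primitive (hΩ : IsOpen Ω) (hΩb : Bornology.IsBounded Ω)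
    (hu : ContinuousOn (fun z : ℝ × EuclideanSpace ℝ (Fin N) => u z.1 z.2) (Ico 0 T ×ˢ closure Ω))
    (hui : Integrable (fun z : ℝ × EuclideanSpace ℝ (Fin N) => u z.1 z.2) (cylMeasure T Ω))
    (hw : IsTimeDeriv T Ω u w) {a b : ℝ} (ha : a ∈ Ioo 0 T) (hb : b ∈ Ioo 0 T) (hab : a < b) :
    ∀ᵐ x ∂(volume.restrict Ω), IntervalIntegrable (fun t => w t x) volume a b ∧
      ∀ t ∈ Icc a b, u t x = u a x + ∫ s in a..t, w s x := by
  have := isFiniteMeasure_restrict hΩb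
  have := isFiniteMeasure_cylMeasure (T := T) hΩb
  have hwi : Integrable (fun z : ℝ × EuclideanSpace ℝ (Fin N) => w z.1 z.2) (cylMeasure T Ω) :=
    hw.1.integrable (by norm_num)
  rw [cylMeasure_eq_prod] at hwi
  have hIcc : Icc a b ⊆ Ioo 0 T := fun t ht => ⟨ha.1.trans_le ht.1, ht.2.trans_lt hb.2⟩
  -- The exceptional null set depends on the pair of times. Restricting to rational end times gives
  -- a single null set, and continuity of both sides in t recovers all times.
  have hrat : ∀ᵐ x ∂(volume.restrict Ω), ∀ r : ℚ, (r : ℝ) ∈ Icc a b →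
      u r x - u a x = ∫ t in a..r, w t x := by
    refine ae_all_iff.2 fun r => ?_
    by_cases hr : (r : ℝ) ∈ Icc a b
    · filter_upwards [hw.ae_sub_eq_integral hΩ hΩb hu hui ha (hIcc hr) hr.1] with x hx _ using hx
    · exact Eventually.of_forall fun x h => absurd h hr
  filter_upwards [hrat, hwi.prod_left_ae, ae_restrict_mem hΩ.measurableSet] with x hx hxi hxΩ
  have hwint : IntervalIntegrable (fun t => w t x) volume a b := by
    rw [intervalIntegrable_iff, uIoc_of_le hab.le]
    exact IntegrableOn.mono_set hxi (Ioc_subset_Icc_self.trans hIcc)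
  refine ⟨hwint, ?_⟩
  have hc1 : ContinuousOn (fun t => u t x) (Icc a b) :=
    hu.comp (f := fun t => (t, x)) (by fun_prop) fun t ht =>
      ⟨⟨(hIcc ht).1.le, (hIcc ht).2⟩, subset_closure hxΩ⟩
  have hc2 : ContinuousOn (fun t => u a x + ∫ s in a..t, w s x) (Icc a b) := by
    have := intervalIntegral.continuousOn_primitive_interval' hwint left_mem_uIcc
    rw [uIcc_of_le hab.le] at this
    exact continuousOn_const.add this
  have heq : EqOn (fun t => u t x) (fun t => u a x + ∫ s in a..t, w s x)
      (Ioo a b ∩ range ((↑) : ℚ → ℝ)) := by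
    rintro _ ⟨ht, r, rfl⟩
    have := hx r (Ioo_subset_Icc_self ht)
    simp only
    linarith
  refine heq.of_subset_closure hc1 hc2 (inter_subset_left.trans Ioo_subset_Icc_self) ?_
  rw [← closure_Ioo hab.ne]
  exact closure_minimal (Rat.denseRange_cast.open_subset_closure_inter isOpen_Ioo) isClosed_closure

lemma aestronglyMeasurable_comp (hΩ : IsOpen Ω)
    (hu : ContinuousOn (fun z : ℝ × EuclideanSpace ℝ (Fin N) => u z.1 z.2) (Ico 0 T ×ˢ closure Ω)) :
    AEStronglyMeasurable (fun z : ℝ × EuclideanSpace ℝ (Fin N) => u z.1 z.2) (cylMeasure T Ω) :=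
  (hu.mono (prod_mono Ioo_subset_Ico_self subset_closure)).aestronglyMeasurable
    (measurableSet_Ioo.prod hΩ.measurableSet)

/-- The chain rule in time, integrated against a spatial weight. -/
lemma IsTimeDeriv.integral_comp_sub (hΩ : IsOpen Ω) (hΩb : Bornology.IsBounded Ω)
    (hu : ContinuousOn (fun z : ℝ × EuclideanSpace ℝ (Fin N) => u z.1 z.2) (Ico 0 T ×ˢ closure Ω))
    (hui : Integrable (fun z : ℝ × EuclideanSpace ℝ (Fin N) => u z.1 z.2) (cylMeasure T Ω))
    (hw : IsTimeDeriv T Ω u w) {a b : ℝ} (ha : a ∈ Ioo 0 T) (hb : b ∈ Ioo 0 T) (hab : a < b)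
    {ρ : EuclideanSpace ℝ (Fin N) → ℝ} (hρ : Continuous ρ) (hρc : HasCompactSupport ρ)
    {Φ H : ℝ → ℝ} {K : NNReal} (hΦ : ∀ y, HasDerivAt Φ (H y) y) (hL : LipschitzWith K Φ)
    (hH : Continuous H) (hH1 : ∀ y, |H y| ≤ 1) :
    (∫ x in Ω, Φ (u b x) * ρ x) - ∫ x in Ω, Φ (u a x) * ρ x =
      ∫ z, w z.1 z.2 * (H (u z.1 z.2) * ρ z.2) * (Ioc a b).indicator (fun _ => (1 : ℝ)) z.1
        ∂(cylMeasure T Ω) := by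
  have := isFiniteMeasure_restrict hΩb
  have := isFiniteMeasure_cylMeasure (T := T) hΩb
  have hwi : Integrable (fun z : ℝ × EuclideanSpace ℝ (Fin N) => w z.1 z.2) (cylMeasure T Ω) :=
    hw.1.integrable (by norm_num)
  obtain ⟨B, hB⟩ := hρ.bounded_above_of_compact_support hρc
  have hmeas := aestronglyMeasurable_comp (T := T) hΩ hu
  have hΦi : ∀ t ∈ Ioo 0 T, Integrable (fun x => Φ (u t x) * ρ x) (volume.restrict Ω) := by
    intro t ht
    have h1 : ContinuousOn (fun x => Φ (u t x) * ρ x) (closure Ω) :=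
      (hL.continuous.comp_continuousOn (hu.comp (f := fun x => (t, x)) (by fun_prop)
        fun x hx => ⟨⟨ht.1.le, ht.2⟩, hx⟩)).mul hρ.continuousOn
    exact (h1.integrableOn_compact hΩb.isCompact_closure).mono_set subset_closure
  have hint : Integrable (fun z : ℝ × EuclideanSpace ℝ (Fin N) =>
      w z.1 z.2 * (H (u z.1 z.2) * ρ z.2) * (Ioc a b).indicator (fun _ => (1 : ℝ)) z.1)
      (cylMeasure T Ω) := by
    refine integrable_mul_indicator_Ioc (hwi.mul_bdd (c := 1 * B) ?_
      (Eventually.of_forall fun z => ?_)) a b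
    · exact (hH.comp_aestronglyMeasurable hmeas).mul
        (hρ.comp continuous_snd).aestronglyMeasurable
    · rw [norm_mul]
      exact mul_le_mul (hH1 _) (hB _) (norm_nonneg _) zero_le_one
  rw [cylMeasure_eq_prod] at hint ⊢
  -- Time is integrated first, so that the one-dimensional chain rule applies to almost every slice
  -- u(·, x).
  rw [integral_prod_symm _ hint, ← integral_sub (hΦi b hb) (hΦi a ha)]
  refine integral_congr_ae ?_
  filter_upwards [hw.ae_eq_primitive hΩ hΩb hu hui ha hb hab] with x hx
  have h1 := integral_comp_mul_eq_sub_of_primitive (f := fun t => u t x) hab.le hx.1 hx.2 hΦ hL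
  rw [← sub_mul, ← h1, intervalIntegral.integral_of_le hab.le, ← integral_mul_const]
  have hsub : Ioc a b ⊆ Ioo 0 T := fun t ht => ⟨ha.1.trans ht.1, ht.2.trans_lt hb.2⟩
  have : ∀ t, w t x * (H (u t x) * ρ x) * (Ioc a b).indicator (fun _ => (1 : ℝ)) t =
      (Ioc a b).indicator (fun t => H (u t x) * w t x * ρ x) t := fun t => by
    by_cases ht : t ∈ Ioc a b
    · simp [ht]; ring
    · simp [ht]
  simp only [this]
  rw [setIntegral_indicator measurableSet_Ioc, inter_eq_self_of_subset_right hsub]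

end StratifiedGroup


/-! ### Horizontal calculus and composition in S_0 -/

/-- Dominated convergence to zero in `L^p`. -/
lemma tendsto_eLpNorm_zero_of_dominated {α F F' : Type*} [MeasurableSpace α] {μ : Measure α}
    [NormedAddCommGroup F] [NormedAddCommGroup F'] {p : ℝ≥0∞} (hp0 : p ≠ 0) (hp : p ≠ ⊤)
    {d : ℕ → α → F} {g : α → F'} (hg : MemLp g p μ) (hd : ∀ n, AEStronglyMeasurable (d n) μ)
    {C : ℝ} (hle : ∀ n x, ‖d n x‖ ≤ C * ‖g x‖)
    (hlim : ∀ᵐ x ∂μ, Tendsto (fun n => d n x) atTop (𝓝 0)) :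
    Tendsto (fun n => eLpNorm (d n) p μ) atTop (𝓝 0) := by
  have hp' : 0 < p.toReal := ENNReal.toReal_pos hp0 hp
  have hfin : ∫⁻ x, (ENNReal.ofReal C * ‖g x‖ₑ) ^ p.toReal ∂μ ≠ ⊤ := by
    simp only [ENNReal.mul_rpow_of_nonneg _ _ hp'.le]
    rw [lintegral_const_mul' _ _ (ENNReal.rpow_ne_top_of_nonneg hp'.le ENNReal.ofReal_ne_top)]
    refine ENNReal.mul_ne_top (ENNReal.rpow_ne_top_of_nonneg hp'.le ENNReal.ofReal_ne_top) ?_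
    exact (lintegral_rpow_enorm_lt_top_of_eLpNorm_lt_top hp0 hp hg.2).ne
  have h1 : Tendsto (fun n => ∫⁻ x, ‖d n x‖ₑ ^ p.toReal ∂μ) atTop (𝓝 (∫⁻ _, 0 ∂μ)) := by
    refine tendsto_lintegral_of_dominated_convergence' _ (fun n => (hd n).enorm.pow_const _)
      (fun n => Eventually.of_forall fun x => ?_) hfin ?_
    · simp only
      gcongr
      rw [← ofReal_norm, ← ofReal_norm, ← ENNReal.ofReal_mul' (norm_nonneg _)]
      exact ENNReal.ofReal_le_ofReal (hle n x)
    · filter_upwards [hlim] with x hx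
      have h2 := (ENNReal.continuous_rpow_const (y := p.toReal)).continuousAt.tendsto.comp hx.enorm
      simpa [ENNReal.zero_rpow_of_pos hp', Function.comp_def] using h2
  rw [lintegral_zero] at h1
  have h3 := (ENNReal.continuous_rpow_const (y := 1 / p.toReal)).continuousAt.tendsto.comp h1
  rw [ENNReal.zero_rpow_of_pos (by positivity)] at h3
  exact h3.congr fun n => (eLpNorm_eq_lintegral_rpow_enorm_toReal hp0 hp).symm

/-- The gradient of H(u) ρ has this shape: a bounded multiple of ∇_H u plus a bounded field. -/
lemma MemLp.bdd_smul_add_bdd {α F : Type*} [MeasurableSpace α] {μ : Measure α} [IsFiniteMeasure μ]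
    [NormedAddCommGroup F] [NormedSpace ℝ F] {p : ℝ≥0∞} {g d : α → F} {a : α → ℝ}
    (hg : MemLp g p μ) (ha : AEStronglyMeasurable a μ) {A D : ℝ} (hA : ∀ x, |a x| ≤ A)
    (hd : AEStronglyMeasurable d μ) (hD : ∀ x, ‖d x‖ ≤ D) :
    MemLp (fun x => a x • g x + d x) p μ := by
  refine MemLp.add (hg.of_le_mul (c := A) (ha.smul hg.1) (Eventually.of_forall fun x => ?_))
    (MemLp.of_bound hd D (Eventually.of_forall hD))
  rw [norm_smul]
  exact mul_le_mul_of_nonneg_right (hA x) (norm_nonneg _)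

namespace StratifiedGroup

variable {N : ℕ} (G : StratifiedGroup N) {Ω : Set (EuclideanSpace ℝ (Fin N))}

lemma continuous_field (j : G.HIndex) : Continuous (G.field j) := by
  have h : ContDiff ℝ ∞ fun x : EuclideanSpace ℝ (Fin N) =>
      fderiv ℝ (fun y => G.group.mul x y) 0 :=
    ContDiff.fderiv (m := ∞) (f := fun x y => G.group.mul x y) G.contDiff_mul contDiff_const (by simp)
  exact h.continuous.clm_apply continuous_const

lemma continuous_hGrad {f : EuclideanSpace ℝ (Fin N) → ℝ} (hf : ContDiff ℝ ∞ f) :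
    Continuous (G.hGrad f) :=
  (PiLp.continuous_toLp 2 _).comp <| continuous_pi fun j =>
    (hf.continuous_fderiv (by simp)).clm_apply (G.continuous_field j)

lemma hGrad_eq_zero {f : EuclideanSpace ℝ (Fin N) → ℝ} {x : EuclideanSpace ℝ (Fin N)}
    (hx : x ∉ tsupport f) : G.hGrad f x = 0 := by
  have h : f =ᶠ[𝓝 x] fun _ => 0 := notMem_tsupport_iff_eventuallyEq.1 hx
  ext j
  simp [hGrad, h.fderiv_eq]

lemma exists_norm_hGrad_le {f : EuclideanSpace ℝ (Fin N) → ℝ} (hf : ContDiff ℝ ∞ f)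
    (hfc : HasCompactSupport f) : ∃ B, ∀ x, ‖G.hGrad f x‖ ≤ B :=
  (G.continuous_hGrad hf).bounded_above_of_compact_support
    (HasCompactSupport.intro hfc fun _ hx => G.hGrad_eq_zero hx)

lemma hGrad_comp {f : EuclideanSpace ℝ (Fin N) → ℝ} {x : EuclideanSpace ℝ (Fin N)}
    (hf : DifferentiableAt ℝ f x) {H : ℝ → ℝ} {H' : ℝ} (hH : HasDerivAt H H' (f x)) :
    G.hGrad (fun y => H (f y)) x = H' • G.hGrad f x := by
  have h := hH.comp_hasFDerivAt x hf.hasFDerivAt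
  ext j
  simp [hGrad, show fderiv ℝ (fun y => H (f y)) x = _ from h.fderiv]

lemma hGrad_mul {f g : EuclideanSpace ℝ (Fin N) → ℝ} {x : EuclideanSpace ℝ (Fin N)}
    (hf : DifferentiableAt ℝ f x) (hg : DifferentiableAt ℝ g x) :
    G.hGrad (fun y => f y * g y) x = g x • G.hGrad f x + f x • G.hGrad g x := by
  have h := hf.hasFDerivAt.mul hg.hasFDerivAt
  ext j
  simp [hGrad, show fderiv ℝ (fun y => f y * g y) x = _ from h.fderiv]
  ring

variable {G} in
-- Hölder's inequality on the bounded set Ω, applied to the approximating sequence. Solutions are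
-- given with exponent max{p, q, s}, whereas test functions need exponent p.
lemma IsS0.mono_exponent (hΩb : Bornology.IsBounded Ω) {p m : ℝ≥0∞} (hpm : p ≤ m)
    {u : EuclideanSpace ℝ (Fin N) → ℝ} {g : EuclideanSpace ℝ (Fin N) → G.HSpace}
    (hu : G.IsS0 Ω m u g) : G.IsS0 Ω p u g := by
  have := isFiniteMeasure_restrict hΩb
  obtain ⟨hum, hgm, ψ, hψ, hψu, hψg⟩ := hu
  rcases eq_or_ne p 0 with rfl | hp0
  · exact ⟨by simpa using hum.1, by simpa using hgm.1, ψ, hψ, by simp, by simp⟩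
  set V : ℝ≥0∞ := (volume.restrict Ω) univ ^ (1 / p.toReal - 1 / m.toReal) with hV
  have hVtop : V ≠ ⊤ := by
    -- For p = ⊤ also m = ⊤, and the exponent is 0. For m = ⊤ alone, `toReal` gives 0 and 1/0 = 0,
    -- so the exponent is 1/p, as Hölder requires.
    rcases eq_or_ne p ⊤ with rfl | hpt
    · rw [top_le_iff.1 hpm] at hV
      simp [hV]
    refine ENNReal.rpow_ne_top_of_nonneg ?_ (measure_ne_top _ _)
    rcases eq_or_ne m ⊤ with rfl | hmt
    · simp
    · exact sub_nonneg.2 (one_div_le_one_div_of_le (ENNReal.toReal_pos hp0 hpt)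
        (ENNReal.toReal_mono hmt hpm))
  have key : ∀ {F : Type} [NormedAddCommGroup F] (f : ℕ → EuclideanSpace ℝ (Fin N) → F),
      (∀ k, AEStronglyMeasurable (f k) (volume.restrict Ω)) →
      Tendsto (fun k => eLpNorm (f k) m (volume.restrict Ω)) atTop (𝓝 0) →
      Tendsto (fun k => eLpNorm (f k) p (volume.restrict Ω)) atTop (𝓝 0) := by
    intro F _ f hf h
    have h1 := ENNReal.Tendsto.mul_const h (Or.inr hVtop)
    rw [zero_mul] at h1
    exact tendsto_of_tendsto_of_tendsto_of_le_of_le tendsto_const_nhds h1 (fun _ => zero_le)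
      fun k => eLpNorm_le_eLpNorm_mul_rpow_measure_univ hpm (hf k)
  refine ⟨hum.mono_exponent hpm, hgm.mono_exponent hpm, ψ, hψ, key _ (fun k => ?_) hψu,
    key _ (fun k => ?_) hψg⟩
  · exact (hψ k).1.continuous.aestronglyMeasurable.sub hum.1
  · exact (G.continuous_hGrad (hψ k).1).aestronglyMeasurable.sub hgm.1

variable {G} in
/-- Composition with a smooth bounded function, followed by localization, preserves `S_0^{1,p}`. -/
lemma IsS0.comp_mul (hΩb : Bornology.IsBounded Ω) {p : ℝ≥0∞} (hp1 : 1 ≤ p) (hp : p ≠ ⊤)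
    {u : EuclideanSpace ℝ (Fin N) → ℝ} {g : EuclideanSpace ℝ (Fin N) → G.HSpace}
    (hu : G.IsS0 Ω p u g) {H H' : ℝ → ℝ} (hH : ContDiff ℝ ∞ H) (hHd : ∀ y, HasDerivAt H (H' y) y)
    (hHb : ∀ y, |H y| ≤ 1) (hH' : Continuous H') (hH'b : ∀ y, |H' y| ≤ 1)
    {ρ : EuclideanSpace ℝ (Fin N) → ℝ} (hρ : ContDiff ℝ ∞ ρ) (hρc : HasCompactSupport ρ)
    (hρΩ : tsupport ρ ⊆ Ω) :
    G.IsS0 Ω p (fun x => H (u x) * ρ x)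
      (fun x => (H' (u x) * ρ x) • g x + H (u x) • G.hGrad ρ x) := by
  have := isFiniteMeasure_restrict hΩb
  have hp0 : p ≠ 0 := (zero_lt_one.trans_le hp1).ne'
  obtain ⟨hum, hgm, ψ, hψ, hψu, hψg⟩ := hu
  obtain ⟨B, hB⟩ := hρ.continuous.bounded_above_of_compact_support hρc
  obtain ⟨D, hD⟩ := G.exists_norm_hGrad_le hρ hρc
  have hB0 : 0 ≤ B := (norm_nonneg _).trans (hB 0)
  have hD0 : 0 ≤ D := (norm_nonneg _).trans (hD 0)
  have hρm : AEStronglyMeasurable ρ (volume.restrict Ω) := hρ.continuous.aestronglyMeasurable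
  have hDm : AEStronglyMeasurable (G.hGrad ρ) (volume.restrict Ω) :=
    (G.continuous_hGrad hρ).aestronglyMeasurable
  have hHu : AEStronglyMeasurable (fun x => H (u x)) (volume.restrict Ω) :=
    hH.continuous.comp_aestronglyMeasurable hum.1
  have hH'u : AEStronglyMeasurable (fun x => H' (u x)) (volume.restrict Ω) :=
    hH'.comp_aestronglyMeasurable hum.1
  have hψm : ∀ k, AEStronglyMeasurable (ψ k) (volume.restrict Ω) :=
    fun k => (hψ k).1.continuous.aestronglyMeasurable
  have hψgm : ∀ k, AEStronglyMeasurable (G.hGrad (ψ k)) (volume.restrict Ω) :=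
    fun k => (G.continuous_hGrad (hψ k).1).aestronglyMeasurable
  have hLip : ∀ a b, |H a - H b| ≤ |a - b| := by
    have : LipschitzWith 1 H := lipschitzWith_of_nnnorm_deriv_le (fun y => (hHd y).differentiableAt)
      fun y => by
        rw [(hHd y).deriv, ← NNReal.coe_le_coe]
        simpa using hH'b y
    intro a b
    simpa [Real.dist_eq] using this.dist_le_mul a b
  -- L^p convergence yields almost everywhere convergence only along a subsequence; it is needed
  -- because H' is merely continuous and H'(ψ_n) must converge pointwise.
  obtain ⟨φ, hφ, hae⟩ := (tendstoInMeasure_of_tendsto_eLpNorm hp0 hψm hum.1 hψu).exists_seq_tendsto_ae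
  have hψu' := hψu.comp hφ.tendsto_atTop
  have hψg' := hψg.comp hφ.tendsto_atTop
  have hgrad : ∀ k x, G.hGrad (fun y => H (ψ k y) * ρ y) x =
      (H' (ψ k x) * ρ x) • G.hGrad (ψ k) x + H (ψ k x) • G.hGrad ρ x := by
    intro k x
    have h1 : DifferentiableAt ℝ (ψ k) x := (hψ k).1.differentiable (by simp) x
    rw [G.hGrad_mul (f := fun y => H (ψ k y))
      ((hHd (ψ k x)).differentiableAt.comp x h1) (hρ.differentiable (by simp) x),
      G.hGrad_comp h1 (hHd _), smul_smul, mul_comm (ρ x)]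
  have hsq : ∀ {F F' : Type} [NormedAddCommGroup F] [NormedAddCommGroup F']
      (c : ℝ) (d : ℕ → EuclideanSpace ℝ (Fin N) → F) (e : ℕ → EuclideanSpace ℝ (Fin N) → F'),
      (∀ n x, ‖d n x‖ ≤ c * ‖e n x‖) →
      Tendsto (fun n => eLpNorm (e n) p (volume.restrict Ω)) atTop (𝓝 0) →
      Tendsto (fun n => eLpNorm (d n) p (volume.restrict Ω)) atTop (𝓝 0) := by
    intro F F' _ _ c d e hde h
    have h1 := ENNReal.Tendsto.const_mul (a := ENNReal.ofReal c) h (Or.inr ENNReal.ofReal_ne_top)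
    rw [mul_zero] at h1
    exact tendsto_of_tendsto_of_tendsto_of_le_of_le tendsto_const_nhds h1 (fun _ => zero_le)
      fun n => eLpNorm_le_mul_eLpNorm_of_ae_le_mul (Eventually.of_forall (hde n)) p
  refine ⟨?_, ?_, fun n x => H (ψ (φ n) x) * ρ x, fun n => ⟨?_, ?_, ?_⟩, ?_, ?_⟩
  · refine MemLp.of_bound (hHu.mul hρm) (1 * B) (Eventually.of_forall fun x => ?_)
    rw [norm_mul]
    exact mul_le_mul (hHb _) (hB _) (norm_nonneg _) zero_le_one
  · refine MemLp.bdd_smul_add_bdd hgm (hH'u.mul hρm) (A := 1 * B) (D := 1 * D) (fun x => ?_)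
      (hHu.smul hDm) fun x => ?_
    · rw [abs_mul]
      exact mul_le_mul (hH'b _) (hB _) (abs_nonneg _) zero_le_one
    · rw [norm_smul]
      exact mul_le_mul (hHb _) (hD _) (norm_nonneg _) zero_le_one
  · exact (hH.comp (hψ _).1).mul hρ
  · exact hρc.mul_left
  · exact (tsupport_mul_subset_right (f := fun x => H (ψ (φ n) x))).trans hρΩ
  · refine hsq B _ (fun n x => ψ (φ n) x - u x) (fun n x => ?_) hψu'
    rw [← sub_mul, norm_mul, mul_comm]
    exact mul_le_mul (hB x) (hLip _ _) (norm_nonneg _) hB0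
  -- The gradient error splits into H'(ψ_n) ρ (∇_H ψ_n - g), controlled by boundedness of H';
  -- (H'(ψ_n) - H'(u)) ρ g, controlled by dominated convergence (hence p ≠ ⊤); and (H(ψ_n) - H(u))
  -- ∇_H ρ, controlled by the Lipschitz bound on H.
  · have e1 : Tendsto (fun n => eLpNorm (fun x => (H' (ψ (φ n) x) * ρ x) •
        (G.hGrad (ψ (φ n)) x - g x)) p (volume.restrict Ω)) atTop (𝓝 0) := by
      refine hsq B _ (fun n x => G.hGrad (ψ (φ n)) x - g x) (fun n x => ?_) hψg'
      rw [norm_smul, norm_mul]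
      refine mul_le_mul_of_nonneg_right ?_ (norm_nonneg _)
      calc _ ≤ 1 * B := mul_le_mul (hH'b _) (hB _) (norm_nonneg _) zero_le_one
        _ = B := one_mul B
    have e2 : Tendsto (fun n => eLpNorm (fun x => ((H' (ψ (φ n) x) - H' (u x)) * ρ x) • g x)
        p (volume.restrict Ω)) atTop (𝓝 0) := by
      refine tendsto_eLpNorm_zero_of_dominated hp0 hp hgm (C := 2 * B) (fun n => ?_)
        (fun n x => ?_) ?_
      · exact (((hH'.comp_aestronglyMeasurable (hψm _)).sub hH'u).mul hρm).smul hgm.1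
      · rw [norm_smul, norm_mul]
        refine mul_le_mul_of_nonneg_right ?_ (norm_nonneg _)
        refine mul_le_mul ?_ (hB _) (norm_nonneg _) (by norm_num)
        calc ‖H' (ψ (φ n) x) - H' (u x)‖ ≤ |H' (ψ (φ n) x)| + |H' (u x)| := norm_sub_le _ _
          _ ≤ 2 := by linarith [hH'b (ψ (φ n) x), hH'b (u x)]
      · filter_upwards [hae] with x hx
        have h1 : Tendsto (fun n => H' (ψ (φ n) x) - H' (u x)) atTop (𝓝 0) := by
          have := ((hH'.tendsto (u x)).comp hx).sub_const (H' (u x))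
          rwa [sub_self] at this
        simpa using (h1.mul_const (ρ x)).smul_const (g x)
    have e3 : Tendsto (fun n => eLpNorm (fun x => (H (ψ (φ n) x) - H (u x)) • G.hGrad ρ x)
        p (volume.restrict Ω)) atTop (𝓝 0) := by
      refine hsq D _ (fun n x => ψ (φ n) x - u x) (fun n x => ?_) hψu'
      rw [norm_smul, mul_comm]
      exact mul_le_mul (hD x) (hLip _ _) (norm_nonneg _) hD0
    have hsum := (e1.add e2).add e3
    simp only [add_zero] at hsum
    refine tendsto_of_tendsto_of_tendsto_of_le_of_le tendsto_const_nhds hsum (fun _ => zero_le)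
      fun n => ?_
    have m1 : AEStronglyMeasurable (fun x => (H' (ψ (φ n) x) * ρ x) •
        (G.hGrad (ψ (φ n)) x - g x)) (volume.restrict Ω) :=
      ((hH'.comp_aestronglyMeasurable (hψm _)).mul hρm).smul ((hψgm _).sub hgm.1)
    have m2 : AEStronglyMeasurable (fun x => ((H' (ψ (φ n) x) - H' (u x)) * ρ x) • g x)
        (volume.restrict Ω) :=
      (((hH'.comp_aestronglyMeasurable (hψm _)).sub hH'u).mul hρm).smul hgm.1
    have m3 : AEStronglyMeasurable (fun x => (H (ψ (φ n) x) - H (u x)) • G.hGrad ρ x)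
        (volume.restrict Ω) :=
      ((hH.continuous.comp_aestronglyMeasurable (hψm _)).sub hHu).smul hDm
    refine le_trans (le_of_eq ?_) ((eLpNorm_add_le (m1.add m2) m3 hp1).trans
      (add_le_add_left (eLpNorm_add_le m1 m2 hp1) _))
    congr 1
    ext1 x
    simp only [Pi.add_apply, hgrad]
    module

end StratifiedGroup


/-! ### Admissible test functions -/

namespace StratifiedGroup

variable {N : ℕ} {G : StratifiedGroup N} {Ω : Set (EuclideanSpace ℝ (Fin N))} {T : ℝ}
  {u w : ℝ → EuclideanSpace ℝ (Fin N) → ℝ} {g : ℝ → EuclideanSpace ℝ (Fin N) → G.HSpace}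

/-- A test function must be continuous up to time T, but u is given only before T and may be
unbounded there; the time cutoff, which vanishes from b < T on, removes the problem. -/
lemma continuousOn_comp_mul_cutoff
    (hu : ContinuousOn (fun z : ℝ × EuclideanSpace ℝ (Fin N) => u z.1 z.2) (Ico 0 T ×ˢ closure Ω))
    {f χ : ℝ → ℝ} (hf : Continuous f) (hχ : Continuous χ) {b : ℝ} (hb : b < T)
    (hχb : ∀ t, b ≤ t → χ t = 0) {ρ : EuclideanSpace ℝ (Fin N) → ℝ} (hρ : Continuous ρ) :
    ContinuousOn (fun z : ℝ × EuclideanSpace ℝ (Fin N) => f (u z.1 z.2) * (χ z.1 * ρ z.2))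
      (Icc 0 T ×ˢ closure Ω) := by
  rintro ⟨t, x⟩ ⟨ht, hx⟩
  by_cases htT : t < T
  · have h1 := hu (t, x) ⟨⟨ht.1, htT⟩, hx⟩
    have h2 : Ico 0 T ×ˢ closure Ω ∈ 𝓝[Icc 0 T ×ˢ closure Ω] (t, x) := by
      have : Iio T ×ˢ (univ : Set (EuclideanSpace ℝ (Fin N))) ∈ 𝓝 (t, x) :=
        (isOpen_Iio.prod isOpen_univ).mem_nhds ⟨htT, trivial⟩
      filter_upwards [self_mem_nhdsWithin, mem_nhdsWithin_of_mem_nhds this] with z hz hz'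
      exact ⟨⟨hz.1.1, hz'.1⟩, hz.2⟩
    exact (hf.continuousAt.comp_continuousWithinAt (h1.mono_of_mem_nhdsWithin h2)).mul
      ((hχ.comp continuous_fst).mul (hρ.comp continuous_snd)).continuousWithinAt
  · have h1 : Ioi b ×ˢ (univ : Set (EuclideanSpace ℝ (Fin N))) ∈ 𝓝 (t, x) :=
      (isOpen_Ioi.prod isOpen_univ).mem_nhds ⟨hb.trans_le (not_lt.1 htT), trivial⟩
    have h2 : (fun z : ℝ × EuclideanSpace ℝ (Fin N) => f (u z.1 z.2) * (χ z.1 * ρ z.2)) =ᶠ[𝓝 (t, x)]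
        fun _ => 0 := by
      filter_upwards [h1] with z hz
      rw [hχb z.1 (le_of_lt hz.1), zero_mul, mul_zero]
    exact (continuousAt_const.congr h2.symm).continuousWithinAt

lemma integrable_of_continuousOn (hΩb : Bornology.IsBounded Ω)
    {f : ℝ × EuclideanSpace ℝ (Fin N) → ℝ} (hf : ContinuousOn f (Icc 0 T ×ˢ closure Ω)) :
    Integrable f (cylMeasure T Ω) :=
  IntegrableOn.mono_set (hf.integrableOn_compact (isCompact_Icc.prod hΩb.isCompact_closure))
    (prod_mono Ioo_subset_Icc_self subset_closure)

lemma hGrad_const_mul {ρ : EuclideanSpace ℝ (Fin N) → ℝ} (hρ : ContDiff ℝ ∞ ρ) (c : ℝ)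
    (x : EuclideanSpace ℝ (Fin N)) : G.hGrad (fun y => c * ρ y) x = c • G.hGrad ρ x :=
  G.hGrad_comp (hρ.differentiable (by simp) x)
    (((hasDerivAt_id (ρ x)).const_mul c).congr_deriv (mul_one c))

variable {H H' χ : ℝ → ℝ} {ρ : EuclideanSpace ℝ (Fin N) → ℝ} {b : ℝ}

/-- The test function `χ(t) H(u) ρ(x)`. -/
lemma isTest_comp_mul (hΩ : IsOpen Ω) (hΩb : Bornology.IsBounded Ω)
    (hu : ContinuousOn (fun z : ℝ × EuclideanSpace ℝ (Fin N) => u z.1 z.2) (Ico 0 T ×ˢ closure Ω))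
    {p m : ℝ} (hp : 1 < p) (hpm : p ≤ m) (hug : G.IsBochnerS0 T Ω (ENNReal.ofReal m) u g)
    (hH : ContDiff ℝ ∞ H) (hHd : ∀ y, HasDerivAt H (H' y) y) (hH0 : ∀ y, 0 ≤ H y)
    (hHb : ∀ y, |H y| ≤ 1) (hH' : Continuous H') (hH'b : ∀ y, |H' y| ≤ 1)
    (hχ : Continuous χ) (hχ0 : ∀ t, 0 ≤ χ t) (hχ1 : ∀ t, |χ t| ≤ 1) (hb : b < T)
    (hχb : ∀ t, b ≤ t → χ t = 0)
    (hρ : ContDiff ℝ ∞ ρ) (hρ0 : ∀ x, 0 ≤ ρ x) (hρc : HasCompactSupport ρ) (hρΩ : tsupport ρ ⊆ Ω) :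
    G.IsTest T Ω p (fun t x => H (u t x) * (χ t * ρ x))
      (fun t x => (H' (u t x) * (χ t * ρ x)) • g t x + H (u t x) • (χ t • G.hGrad ρ x)) := by
  have := isFiniteMeasure_restrict hΩb
  have := isFiniteMeasure_cylMeasure (T := T) hΩb
  have hpm' : ENNReal.ofReal p ≤ ENNReal.ofReal m := ENNReal.ofReal_le_ofReal hpm
  have hcont := continuousOn_comp_mul_cutoff hu hH.continuous hχ hb hχb hρ.continuous
  obtain ⟨B, hB⟩ := hρ.continuous.bounded_above_of_compact_support hρc
  obtain ⟨D, hD⟩ := G.exists_norm_hGrad_le hρ hρc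
  have hum := aestronglyMeasurable_comp (T := T) hΩ hu
  have hχρ : AEStronglyMeasurable (fun z : ℝ × EuclideanSpace ℝ (Fin N) => χ z.1 * ρ z.2)
      (cylMeasure T Ω) :=
    ((hχ.comp continuous_fst).mul (hρ.continuous.comp continuous_snd)).aestronglyMeasurable
  have hχρB : ∀ z : ℝ × EuclideanSpace ℝ (Fin N), |χ z.1 * ρ z.2| ≤ 1 * B := fun z => by
    rw [abs_mul]
    exact mul_le_mul (hχ1 _) (hB _) (abs_nonneg _) zero_le_one
  refine ⟨hcont, fun t _ x _ => mul_nonneg (hH0 _) (mul_nonneg (hχ0 t) (hρ0 x)),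
    fun t _ x hx => ?_, ?_, ?_, ?_⟩
  · have : x ∉ tsupport ρ := fun h => (hΩ.frontier_eq ▸ hx).2 (hρΩ h)
    simp [image_eq_zero_of_notMem_tsupport this]
  · refine MemLp.of_bound ((hH.continuous.comp_aestronglyMeasurable hum).mul hχρ) (1 * (1 * B))
      (Eventually.of_forall fun z => ?_)
    rw [norm_mul]
    exact mul_le_mul (hHb _) (hχρB z) (norm_nonneg _) zero_le_one
  · refine MemLp.bdd_smul_add_bdd (hug.2.1.mono_exponent hpm')
      ((hH'.comp_aestronglyMeasurable hum).mul hχρ) (A := 1 * (1 * B)) (D := 1 * (1 * D))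
      (fun z => ?_) ?_ fun z => ?_
    · rw [abs_mul]
      exact mul_le_mul (hH'b _) (hχρB z) (abs_nonneg _) zero_le_one
    · exact (hH.continuous.comp_aestronglyMeasurable hum).smul ((hχ.comp continuous_fst).smul
        ((G.continuous_hGrad hρ).comp continuous_snd)).aestronglyMeasurable
    · rw [norm_smul, norm_smul]
      exact mul_le_mul (hHb _) (mul_le_mul (hχ1 _) (hD _) (norm_nonneg _) zero_le_one)
        (by positivity) zero_le_one
  · filter_upwards [hug.2.2] with t ht
    have h := (ht.mono_exponent hΩb hpm').comp_mul hΩb (by simpa using hp.le)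
      ENNReal.ofReal_ne_top hH hHd hHb hH' hH'b (ρ := fun x => χ t * ρ x) (contDiff_const.mul hρ)
      hρc.mul_left ((tsupport_mul_subset_right (f := fun _ => χ t)).trans hρΩ)
    simpa only [hGrad_const_mul hρ] using h

/-- The gradient term of the weak formulation is integrable. -/
lemma integrable_gradient_term {E : Type*} [NormedAddCommGroup E] [InnerProductSpace ℝ E]
    {X : Type*} [MeasurableSpace X] {μ : Measure X} [IsFiniteMeasure μ] {p : ℝ} (hp : 1 < p)
    {g : X → E} (hg : MemLp g (ENNReal.ofReal p) μ) {a : X → ℝ} {d : X → E}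
    (ha : AEStronglyMeasurable a μ) {A D : ℝ} (hA : ∀ x, |a x| ≤ A)
    (hd : AEStronglyMeasurable d μ) (hD : ∀ x, ‖d x‖ ≤ D) :
    Integrable (fun x => ‖g x‖ ^ (p - 2) * inner ℝ (g x) (a x • g x + d x)) μ := by
  have hp0 : 0 < p := by linarith
  have h1 : Integrable (fun x => ‖g x‖ ^ p) μ := by
    have := hg.integrable_norm_rpow (by simpa using hp0) ENNReal.ofReal_ne_top
    simpa [ENNReal.toReal_ofReal hp0.le] using this
  refine ((h1.const_mul (A + D)).add (integrable_const D)).mono' ?_ (Eventually.of_forall fun x => ?_)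
  · have h2 : AEStronglyMeasurable (fun x => ‖g x‖ ^ (p - 2)) μ :=
      (hg.1.norm.aemeasurable.pow_const _).aestronglyMeasurable
    exact h2.mul (hg.1.inner ((ha.smul hg.1).add hd))
  · have hA0 : 0 ≤ A := (abs_nonneg _).trans (hA x)
    have hD0 : 0 ≤ D := (norm_nonneg _).trans (hD x)
    have hn := norm_nonneg (g x)
    have e1 : ‖a x • g x + d x‖ ≤ A * ‖g x‖ + D := by
      refine (norm_add_le _ _).trans (add_le_add ?_ (hD x))
      rw [norm_smul]
      exact mul_le_mul_of_nonneg_right (hA x) hn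
    have e2 : |inner ℝ (g x) (a x • g x + d x)| ≤ ‖g x‖ * (A * ‖g x‖ + D) :=
      (abs_real_inner_le_norm _ _).trans (mul_le_mul_of_nonneg_left e1 hn)
    rw [Real.norm_eq_abs, abs_mul, abs_of_nonneg (Real.rpow_nonneg hn _)]
    -- The exponent p - 2 may be negative, so points where the gradient vanishes are separated;
    -- there the inner product is zero.
    rcases hn.eq_or_lt with h0 | h0
    · have : g x = 0 := norm_eq_zero.1 h0.symm
      simp only [this, inner_zero_left, abs_zero, mul_zero, Pi.add_apply]
      positivity
    have e3 : ‖g x‖ ^ (p - 2) * ‖g x‖ * ‖g x‖ = ‖g x‖ ^ p := by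
      rw [← Real.rpow_add_one h0.ne', ← Real.rpow_add_one h0.ne']; ring_nf
    have e4 : ‖g x‖ ^ (p - 2) * ‖g x‖ ≤ ‖g x‖ ^ p + 1 := by
      rw [← Real.rpow_add_one h0.ne']
      rcases le_total ‖g x‖ 1 with h | h
      · have := Real.rpow_le_one hn h (show 0 ≤ p - 2 + 1 by linarith)
        linarith [Real.rpow_nonneg hn p]
      · have := Real.rpow_le_rpow_of_exponent_le h (show p - 2 + 1 ≤ p by linarith)
        linarith
    calc ‖g x‖ ^ (p - 2) * |inner ℝ (g x) (a x • g x + d x)|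
        ≤ ‖g x‖ ^ (p - 2) * (‖g x‖ * (A * ‖g x‖ + D)) := by gcongr
      _ = A * (‖g x‖ ^ (p - 2) * ‖g x‖ * ‖g x‖) + D * (‖g x‖ ^ (p - 2) * ‖g x‖) := by ring
      _ ≤ A * ‖g x‖ ^ p + D * (‖g x‖ ^ p + 1) := by rw [e3]; gcongr
      _ = _ := by simp only [Pi.add_apply]; ring

end StratifiedGroup


/-! ### The integrated differential inequality -/

lemma abs_rpow_sub_one_mul_self {r q : ℝ} (hr : 0 ≤ r) (hq : 0 < q) : |r| ^ (q - 1) * r = r ^ q := by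
  rw [abs_of_nonneg hr, ← Real.rpow_add_one' hr (by linarith)]
  ring_nf

/-- Cauchy–Schwarz is applied only to the d-part. The contribution a ‖g‖^p is kept exactly, since
the coefficient a may be negative and then carries the coercivity. -/
lemma norm_rpow_mul_inner_le {E : Type*} [NormedAddCommGroup E] [InnerProductSpace ℝ E]
    (g d : E) {p a b e : ℝ} (hp : 1 < p) (hb : 0 ≤ b) (hd : ‖d‖ ≤ e) :
    ‖g‖ ^ (p - 2) * inner ℝ g (a • g + b • d) ≤ a * ‖g‖ ^ p + b * (‖g‖ ^ (p - 1) * e) := by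
  have hn := norm_nonneg g
  rcases hn.eq_or_lt with h0 | h0
  · have : g = 0 := norm_eq_zero.1 h0.symm
    have hp0 : p ≠ 0 := by linarith
    have hp1 : p - 1 ≠ 0 := by linarith
    simp [this, Real.zero_rpow hp0, Real.zero_rpow hp1]
  have e1 : ‖g‖ ^ (p - 2) * ‖g‖ = ‖g‖ ^ (p - 1) := by
    rw [← Real.rpow_add_one h0.ne']; ring_nf
  have e2 : ‖g‖ ^ (p - 1) * ‖g‖ = ‖g‖ ^ p := by
    rw [← Real.rpow_add_one h0.ne']; ring_nf
  have e3 : inner ℝ g d ≤ ‖g‖ * e :=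
    (real_inner_le_norm g d).trans (mul_le_mul_of_nonneg_left hd hn)
  rw [inner_add_right, inner_smul_right, inner_smul_right, real_inner_self_eq_norm_sq]
  calc ‖g‖ ^ (p - 2) * (a * ‖g‖ ^ 2 + b * inner ℝ g d)
      ≤ ‖g‖ ^ (p - 2) * (a * ‖g‖ ^ 2 + b * (‖g‖ * e)) := by gcongr
    _ = a * ((‖g‖ ^ (p - 2) * ‖g‖) * ‖g‖) + b * ((‖g‖ ^ (p - 2) * ‖g‖) * e) := by ring
    _ = _ := by rw [e1, e2]

namespace StratifiedGroup

variable {N : ℕ} {G : StratifiedGroup N} {Ω : Set (EuclideanSpace ℝ (Fin N))} {T : ℝ}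
  {u w : ℝ → EuclideanSpace ℝ (Fin N) → ℝ} {g : ℝ → EuclideanSpace ℝ (Fin N) → G.HSpace}
  {u₀ : EuclideanSpace ℝ (Fin N) → ℝ}

/-- The weak formulation tested with `χ(t) H(u) ψ^k`, after absorption of the gradient terms. -/
lemma IsWeakSuper.integral_cutoff_le (hΩ : IsOpen Ω) (hΩb : Bornology.IsBounded Ω)
    {α γ p q s : ℝ} (hp : 1 < p) (hq : 1 < q) (hs : 0 < s)
    (hsup : G.IsWeakSuper T Ω α γ p q s u₀ u g w)
    {ψ : EuclideanSpace ℝ (Fin N) → ℝ} (hψ : ContDiff ℝ ∞ ψ) (hψ0 : ∀ x, 0 ≤ ψ x)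
    (hψ1 : ∀ x, ψ x ≤ 1) {k : ℕ} (hρc : HasCompactSupport fun x => ψ x ^ k)
    (hρΩ : tsupport (fun x => ψ x ^ k) ⊆ Ω) {C₀ c C : ℝ}
    (hgrad : ∀ x, ‖G.hGrad (fun y => ψ y ^ k) x‖ ≤ C₀ * ψ x ^ (k - 1))
    (hest : ∀ r a y : ℝ, 0 ≤ r → 0 ≤ a → 0 ≤ y → y ≤ 1 →
      c * (multiplierPrim r ^ (2 * q - 1) * y ^ k) - C ≤
        -multiplierDeriv r * y ^ k * a ^ p - multiplier r * (a ^ (p - 1) * (C₀ * y ^ (k - 1))) +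
          (α * r ^ q + γ * r ^ s) * (multiplier r * y ^ k))
    {χ : ℝ → ℝ} (hχ : Continuous χ) (hχ0 : ∀ t, 0 ≤ χ t) (hχ1 : ∀ t, |χ t| ≤ 1) {b : ℝ} (hb : b < T)
    (hχb : ∀ t, b ≤ t → χ t = 0) :
    ∫ z, (c * (multiplierPrim (u z.1 z.2) ^ (2 * q - 1) * ψ z.2 ^ k) - C) * χ z.1
        ∂(cylMeasure T Ω) ≤
      ∫ z, w z.1 z.2 * (multiplier (u z.1 z.2) * ψ z.2 ^ k) * χ z.1 ∂(cylMeasure T Ω) := by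
  have := isFiniteMeasure_restrict hΩb
  have := isFiniteMeasure_cylMeasure (T := T) hΩb
  obtain ⟨⟨hu0, hu, hug, hw⟩, -, -, hweak⟩ := hsup
  have hpm : p ≤ max p (max q s) := le_max_left _ _
  set ρ : EuclideanSpace ℝ (Fin N) → ℝ := fun x => ψ x ^ k with hρdef
  have hρ : ContDiff ℝ ∞ ρ := hψ.pow k
  have hρ0 : ∀ x, 0 ≤ ρ x := fun x => pow_nonneg (hψ0 x) k
  have hρ1 : ∀ x, |ρ x| ≤ 1 := fun x => by
    rw [abs_of_nonneg (hρ0 x)]; exact pow_le_one₀ (hψ0 x) (hψ1 x)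
  have hHabs : ∀ y, |multiplier y| ≤ 1 := fun y => by
    rw [abs_of_pos (multiplier_pos y)]; exact multiplier_le_one y
  have htest := isTest_comp_mul hΩ hΩb hu hp hpm hug contDiff_multiplier hasDerivAt_multiplier
    (fun y => (multiplier_pos y).le) hHabs continuous_multiplierDeriv abs_multiplierDeriv_le
    hχ hχ0 hχ1 hb hχb hρ hρ0 hρc hρΩ
  have hineq := hweak _ _ htest
  unfold sourceForm parabolicForm at hineq
  have hum := aestronglyMeasurable_comp (T := T) hΩ hu
  have hmem : ∀ᵐ z ∂(cylMeasure T Ω), z ∈ Ioo 0 T ×ˢ Ω :=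
    ae_restrict_mem (measurableSet_Ioo.prod hΩ.measurableSet)
  have hupos : ∀ᵐ z ∂(cylMeasure T Ω), 0 ≤ u z.1 z.2 := by
    filter_upwards [hmem] with z hz using
      hu0 z.1 (Ioo_subset_Ico_self hz.1) z.2 (subset_closure hz.2)
  have hχm : AEStronglyMeasurable (fun z : ℝ × EuclideanSpace ℝ (Fin N) => χ z.1)
    (cylMeasure T Ω) := (hχ.comp continuous_fst).aestronglyMeasurable
  have hχρ : AEStronglyMeasurable (fun z : ℝ × EuclideanSpace ℝ (Fin N) => χ z.1 * ρ z.2)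
    (cylMeasure T Ω) := hχm.mul (hρ.continuous.comp continuous_snd).aestronglyMeasurable
  have hχρ1 : ∀ z : ℝ × EuclideanSpace ℝ (Fin N), |χ z.1 * ρ z.2| ≤ 1 := fun z => by
    rw [abs_mul]; exact mul_le_one₀ (hχ1 _) (abs_nonneg _) (hρ1 _)
  have hHm : AEStronglyMeasurable (fun z : ℝ × EuclideanSpace ℝ (Fin N) =>
    multiplier (u z.1 z.2)) (cylMeasure T Ω) :=
    continuous_multiplier.comp_aestronglyMeasurable hum
  obtain ⟨D, hD⟩ := G.exists_norm_hGrad_le hρ hρc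
  -- integrability of all the terms
  have hwi : Integrable (fun z : ℝ × EuclideanSpace ℝ (Fin N) =>
      w z.1 z.2 * (multiplier (u z.1 z.2) * (χ z.1 * ρ z.2))) (cylMeasure T Ω) := by
    refine (hw.1.integrable (by norm_num)).mul_bdd (c := 1) (hHm.mul hχρ)
      (Eventually.of_forall fun z => ?_)
    rw [norm_mul]
    exact mul_le_one₀ (hHabs _) (norm_nonneg _) (hχρ1 z)
  have hgi : Integrable (fun z : ℝ × EuclideanSpace ℝ (Fin N) => ‖g z.1 z.2‖ ^ (p - 2) *
      inner ℝ (g z.1 z.2) ((multiplierDeriv (u z.1 z.2) * (χ z.1 * ρ z.2)) • g z.1 z.2 +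
        multiplier (u z.1 z.2) • (χ z.1 • G.hGrad ρ z.2))) (cylMeasure T Ω) := by
    refine integrable_gradient_term hp (hug.2.1.mono_exponent (ENNReal.ofReal_le_ofReal hpm))
      ((continuous_multiplierDeriv.comp_aestronglyMeasurable hum).mul hχρ) (A := 1) (D := 1 * (1 * D))
      (fun z => ?_) ?_ fun z => ?_
    · rw [abs_mul]
      exact mul_le_one₀ (abs_multiplierDeriv_le _) (abs_nonneg _) (hχρ1 z)
    · exact hHm.smul (hχm.smul ((G.continuous_hGrad hρ).comp continuous_snd).aestronglyMeasurable)
    · rw [norm_smul, norm_smul]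
      exact mul_le_mul (hHabs _) (mul_le_mul (hχ1 _) (hD _) (norm_nonneg _) zero_le_one)
        (by positivity) zero_le_one
  have hSi : Integrable (fun z : ℝ × EuclideanSpace ℝ (Fin N) =>
      (α * (|u z.1 z.2| ^ (q - 1) * u z.1 z.2) + γ * (|u z.1 z.2| ^ (s - 1) * u z.1 z.2)) *
        (multiplier (u z.1 z.2) * (χ z.1 * ρ z.2))) (cylMeasure T Ω) := by
    -- Replacing r by its positive part makes the source a continuous function on the whole line and
    -- changes nothing almost everywhere, as u ≥ 0.
    have hf : Continuous fun r : ℝ => (α * (max r 0) ^ q + γ * (max r 0) ^ s) * multiplier r := by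
      refine Continuous.mul (Continuous.add (continuous_const.mul ?_) (continuous_const.mul ?_))
        continuous_multiplier
      · exact (continuous_id.max continuous_const).rpow_const fun _ => Or.inr (by linarith)
      · exact (continuous_id.max continuous_const).rpow_const fun _ => Or.inr hs.le
    refine (integrable_of_continuousOn hΩb
      (continuousOn_comp_mul_cutoff hu hf hχ hb hχb hρ.continuous)).congr ?_
    filter_upwards [hupos] with z hz
    rw [abs_rpow_sub_one_mul_self hz (by linarith), abs_rpow_sub_one_mul_self hz hs,
      max_eq_left hz]
    ring
  have hLi : Integrable (fun z : ℝ × EuclideanSpace ℝ (Fin N) =>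
      (c * (multiplierPrim (u z.1 z.2) ^ (2 * q - 1) * ψ z.2 ^ k) - C) * χ z.1)
      (cylMeasure T Ω) := by
    have hf : Continuous fun r : ℝ => c * multiplierPrim r ^ (2 * q - 1) :=
      continuous_const.mul (continuous_multiplierPrim.rpow_const fun _ => Or.inr (by linarith))
    have h1 := integrable_of_continuousOn hΩb
      (continuousOn_comp_mul_cutoff hu hf hχ hb hχb hρ.continuous)
    have h2 : Integrable (fun z : ℝ × EuclideanSpace ℝ (Fin N) => C * χ z.1) (cylMeasure T Ω) :=
      integrable_of_continuousOn hΩb (by fun_prop)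
    refine (h1.sub h2).congr (Eventually.of_forall fun z => ?_)
    simp only [Pi.sub_apply, hρdef]
    ring
  rw [integral_add hwi hgi] at hineq
  -- The pointwise estimate with r = u, a = |∇_H u|, y = ψ, multiplied by χ ≥ 0. Combined with the
  -- weak inequality, it eliminates both the source and the gradient integrals.
  have hpt := integral_mono_ae hLi (hSi.sub hgi) (by
    filter_upwards [hupos] with z hz
    simp only [Pi.sub_apply]
    rw [abs_rpow_sub_one_mul_self hz (by linarith), abs_rpow_sub_one_mul_self hz hs, smul_smul]
    have h1 := norm_rpow_mul_inner_le (g z.1 z.2) (G.hGrad ρ z.2)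
      (a := multiplierDeriv (u z.1 z.2) * (χ z.1 * ρ z.2)) (b := multiplier (u z.1 z.2) * χ z.1)
      hp (mul_nonneg (multiplier_pos _).le (hχ0 _)) (hgrad z.2)
    have h2 := mul_le_mul_of_nonneg_right
      (hest (u z.1 z.2) ‖g z.1 z.2‖ (ψ z.2) hz (norm_nonneg _) (hψ0 _) (hψ1 _)) (hχ0 z.1)
    refine h2.trans (le_trans (le_of_eq ?_) (sub_le_sub_left h1 _))
    simp only [hρdef]
    ring)
  simp only [Pi.sub_apply] at hpt
  rw [integral_sub hSi hgi] at hpt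
  have hZ : ∫ z, w z.1 z.2 * (multiplier (u z.1 z.2) * ψ z.2 ^ k) * χ z.1 ∂(cylMeasure T Ω) =
      ∫ z, w z.1 z.2 * (multiplier (u z.1 z.2) * (χ z.1 * ρ z.2)) ∂(cylMeasure T Ω) :=
    integral_congr_ae (Eventually.of_forall fun z => by simp only [hρdef]; ring)
  rw [hZ]
  linarith

/-- The integrated differential inequality for the weighted functional. -/
lemma IsWeakSuper.integral_le_sub (hΩ : IsOpen Ω) (hΩb : Bornology.IsBounded Ω)
    {α γ p q s : ℝ} (hp : 1 < p) (hq : 1 < q) (hs : 0 < s)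
    (hsup : G.IsWeakSuper T Ω α γ p q s u₀ u g w)
    {ψ : EuclideanSpace ℝ (Fin N) → ℝ} (hψ : ContDiff ℝ ∞ ψ) (hψ0 : ∀ x, 0 ≤ ψ x)
    (hψ1 : ∀ x, ψ x ≤ 1) {k : ℕ} (hρc : HasCompactSupport fun x => ψ x ^ k)
    (hρΩ : tsupport (fun x => ψ x ^ k) ⊆ Ω) {C₀ c C : ℝ}
    (hgrad : ∀ x, ‖G.hGrad (fun y => ψ y ^ k) x‖ ≤ C₀ * ψ x ^ (k - 1))
    (hest : ∀ r a y : ℝ, 0 ≤ r → 0 ≤ a → 0 ≤ y → y ≤ 1 →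
      c * (multiplierPrim r ^ (2 * q - 1) * y ^ k) - C ≤
        -multiplierDeriv r * y ^ k * a ^ p - multiplier r * (a ^ (p - 1) * (C₀ * y ^ (k - 1))) +
          (α * r ^ q + γ * r ^ s) * (multiplier r * y ^ k))
    {a b : ℝ} (ha : a ∈ Ioo 0 T) (hb : b ∈ Ioo 0 T) (hab : a < b) :
    ∫ t in a..b, ∫ x in Ω, (c * (multiplierPrim (u t x) ^ (2 * q - 1) * ψ x ^ k) - C) ≤
      (∫ x in Ω, multiplierPrim (u b x) * ψ x ^ k) - ∫ x in Ω, multiplierPrim (u a x) * ψ x ^ k := by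
  have := isFiniteMeasure_restrict hΩb
  have := isFiniteMeasure_cylMeasure (T := T) hΩb
  obtain ⟨hu0, hu, hug, hw⟩ := hsup.1
  have hum := aestronglyMeasurable_comp (T := T) hΩ hu
  have hui : Integrable (fun z : ℝ × EuclideanSpace ℝ (Fin N) => u z.1 z.2) (cylMeasure T Ω) :=
    hug.1.integrable (by
      simpa using (hp.le.trans (le_max_left p (max q s))))
  have hHabs : ∀ y, |multiplier y| ≤ 1 := fun y => by
    rw [abs_of_pos (multiplier_pos y)]; exact multiplier_le_one y
  -- The integrand `L` need not be integrable up to T. It is truncated at b' between b and T; for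
  -- large n the cutoff vanishes beyond b', so the truncation has no effect on the integrals.
  set b' : ℝ := (b + T) / 2 with hb'
  have hbb' : b < b' := by linarith [hb.2]
  have hb'T : b' < T := by linarith [hb.2]
  set L : ℝ × EuclideanSpace ℝ (Fin N) → ℝ := fun z =>
    c * (multiplierPrim (u z.1 z.2) ^ (2 * q - 1) * ψ z.2 ^ k) - C with hL
  have hms : MeasurableSet (Iic b' ×ˢ (univ : Set (EuclideanSpace ℝ (Fin N)))) :=
    measurableSet_Iic.prod MeasurableSet.univ
  set L' := (Iic b' ×ˢ (univ : Set (EuclideanSpace ℝ (Fin N)))).indicator L with hL'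
  have hL'i : Integrable L' (cylMeasure T Ω) := by
    rw [hL', integrable_indicator_iff hms, IntegrableOn, cylMeasure, Measure.restrict_restrict hms]
    have hLc : ContinuousOn L (Icc 0 b' ×ˢ closure Ω) := by
      have hu' := hu.mono (prod_mono_left (t := closure Ω)
        (show Icc 0 b' ⊆ Ico 0 T from fun t ht => ⟨ht.1, ht.2.trans_lt hb'T⟩))
      have h1 : Continuous fun r : ℝ => multiplierPrim r ^ (2 * q - 1) :=
        continuous_multiplierPrim.rpow_const fun _ => Or.inr (by linarith)
      exact (continuousOn_const.mul ((h1.comp_continuousOn hu').mul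
        ((hψ.continuous.comp continuous_snd).pow k).continuousOn)).sub continuousOn_const
    exact (hLc.integrableOn_compact (isCompact_Icc.prod hΩb.isCompact_closure)).mono_set
      fun z hz => ⟨⟨hz.2.1.1.le, hz.1.1⟩, subset_closure hz.2.2⟩
  have hZi : Integrable (fun z : ℝ × EuclideanSpace ℝ (Fin N) =>
      w z.1 z.2 * (multiplier (u z.1 z.2) * ψ z.2 ^ k)) (cylMeasure T Ω) := by
    refine (hw.1.integrable (by norm_num)).mul_bdd (c := 1)
      ((continuous_multiplier.comp_aestronglyMeasurable hum).mul
        ((hψ.continuous.comp continuous_snd).pow k).aestronglyMeasurable)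
      (Eventually.of_forall fun z => ?_)
    rw [norm_mul]
    refine mul_le_one₀ (hHabs _) (norm_nonneg _) ?_
    rw [Real.norm_eq_abs, abs_of_nonneg (pow_nonneg (hψ0 _) k)]
    exact pow_le_one₀ (hψ0 _) (hψ1 _)
  have hlim := le_of_tendsto_of_tendsto (tendsto_integral_mul_smoothStep_sub hL'i hab.le)
    (tendsto_integral_mul_smoothStep_sub hZi hab.le) (by
      filter_upwards [eventually_one_div_add_one_lt (sub_pos.2 hbb')] with n hn
      have hχb : ∀ t, b' ≤ t → smoothStep n a t - smoothStep n b t = 0 := fun t ht => by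
        rw [smoothStep_eq_one (by linarith), smoothStep_eq_one (by linarith), sub_self]
      have h := hsup.integral_cutoff_le hΩ hΩb hp hq hs hψ hψ0 hψ1 hρc hρΩ hgrad hest
        (χ := fun t => smoothStep n a t - smoothStep n b t)
        ((contDiff_smoothStep n a).sub (contDiff_smoothStep n b)).continuous
        (fun t => sub_nonneg.2 (Real.smoothTransition.monotone (by gcongr)))
        (abs_smoothStep_sub_le_one n a b) hb'T hχb
      refine le_trans (le_of_eq (integral_congr_ae (Eventually.of_forall fun z => ?_))) h
      by_cases hz : z.1 ≤ b'
      · simp only [hL', hL]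
        rw [indicator_of_mem (by exact ⟨hz, trivial⟩)]
      · simp only [hχb z.1 (not_le.1 hz).le, mul_zero])
  rw [hw.integral_comp_sub hΩ hΩb hu hui ha hb hab (ρ := fun x => ψ x ^ k) (hψ.continuous.pow k) hρc
    hasDerivAt_multiplierPrim lipschitzWith_multiplierPrim continuous_multiplier hHabs]
  refine le_trans (le_of_eq ?_) hlim
  have hint := integrable_mul_indicator_Ioc hL'i a b
  rw [cylMeasure_eq_prod] at hint ⊢
  rw [integral_prod _ hint, intervalIntegral.integral_of_le hab.le]
  have hsub : Ioc a b ⊆ Ioo 0 T := fun t ht => ⟨ha.1.trans ht.1, ht.2.trans_lt hb.2⟩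
  have : ∀ t, ∫ x in Ω, L' (t, x) * (Ioc a b).indicator (fun _ => (1 : ℝ)) t =
      (Ioc a b).indicator (fun t => ∫ x in Ω, L (t, x)) t := fun t => by
    by_cases ht : t ∈ Ioc a b
    · simp only [indicator_of_mem ht, mul_one]
      refine integral_congr_ae (Eventually.of_forall fun x => ?_)
      simp only [hL']
      rw [indicator_of_mem (by exact ⟨ht.2.trans hbb'.le, trivial⟩)]
    · simp [ht]
  simp only [this]
  rw [setIntegral_indicator measurableSet_Ioc, inter_eq_self_of_subset_right hsub]

end StratifiedGroup


/-! ### Jensen's inequality, positive data and the blow-up criterion -/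

/-- Jensen's inequality for powers, with respect to a weight. -/
lemma rpow_integral_mul_le {X : Type*} [MeasurableSpace X] {μ : Measure X} {f ρ : X → ℝ} {κ : ℝ}
    (hκ : 1 ≤ κ) (hf : Integrable (fun x => f x * ρ x) μ) (hρ : Integrable ρ μ)
    (hfκ : Integrable (fun x => f x ^ κ * ρ x) μ) (hf0 : ∀ᵐ x ∂μ, 0 ≤ f x) (hρ0 : ∀ x, 0 ≤ ρ x)
    (hm : 0 < ∫ x, ρ x ∂μ) :
    (∫ x, ρ x ∂μ) ^ (1 - κ) * (∫ x, f x * ρ x ∂μ) ^ κ ≤ ∫ x, f x ^ κ * ρ x ∂μ := by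
  set m := ∫ x, ρ x ∂μ with hmdef
  set F := ∫ x, f x * ρ x ∂μ with hF
  have hF0 : 0 ≤ F := integral_nonneg_of_ae (by
    filter_upwards [hf0] with x hx using mul_nonneg hx (hρ0 x))
  rcases hF0.eq_or_lt with h0 | h0
  · rw [← h0, Real.zero_rpow (by linarith), mul_zero]
    refine integral_nonneg_of_ae ?_
    filter_upwards [hf0] with x hx using mul_nonneg (Real.rpow_nonneg hx _) (hρ0 x)
  set l := F / m with hl
  have hl0 : 0 < l := by positivity
  have key : ∫ x, (l ^ κ * (κ / l) * (f x * ρ x) + l ^ κ * (1 - κ) * ρ x) ∂μ ≤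
      ∫ x, f x ^ κ * ρ x ∂μ := by
    refine integral_mono_ae ((hf.const_mul _).add (hρ.const_mul _)) hfκ ?_
    filter_upwards [hf0] with x hx
    -- Bernoulli's inequality says that x^κ lies above its tangent at the weighted mean l;
    -- integrating the tangent line gives the claim.
    have h1 := one_add_mul_self_le_rpow_one_add (s := f x / l - 1)
      (by linarith [div_nonneg hx hl0.le]) hκ
    rw [add_sub_cancel, Real.div_rpow hx hl0.le, le_div_iff₀ (by positivity)] at h1
    have h2 := mul_le_mul_of_nonneg_right h1 (hρ0 x)
    refine le_trans (le_of_eq ?_) h2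
    field_simp
    ring
  rw [integral_add (hf.const_mul _) (hρ.const_mul _), integral_const_mul, integral_const_mul,
    ← hmdef, ← hF] at key
  refine le_trans (le_of_eq ?_) key
  have h3 : F = l * m := (div_mul_cancel₀ F hm.ne').symm
  rw [h3, Real.mul_rpow hl0.le hm.le, Real.rpow_sub hm, Real.rpow_one]
  field_simp
  ring

lemma tendsto_eLpNorm_top_zero {α F : Type*} [MeasurableSpace α] {μ : Measure α}
    [NormedAddCommGroup F] {d : ℕ → α → F} (h : ∀ ε > 0, ∀ᶠ n in atTop, ∀ x, ‖d n x‖ ≤ ε) :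
    Tendsto (fun n => eLpNorm (d n) ⊤ μ) atTop (𝓝 0) := by
  rw [ENNReal.tendsto_nhds_zero]
  intro ε hε
  rcases eq_or_ne ε ⊤ with rfl | hεt
  · simp
  filter_upwards [h ε.toReal (ENNReal.toReal_pos hε.ne' hεt)] with n hn
  rw [eLpNorm_exponent_top]
  exact (eLpNormEssSup_le_of_ae_bound (Eventually.of_forall hn)).trans
    (ENNReal.ofReal_toReal hεt).le

namespace StratifiedGroup

variable {N : ℕ} (G : StratifiedGroup N) {Ω : Set (EuclideanSpace ℝ (Fin N))}

/-- There is an initial datum that is positive in `Ω`, along with all its positive multiples. -/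
lemma exists_isInitialDatum_pos (hΩ : IsOpen Ω) (hΩb : Bornology.IsBounded Ω)
    (hΩne : Ω.Nonempty) : ∃ φ : EuclideanSpace ℝ (Fin N) → ℝ, ∀ c : ℝ, 0 < c →
      G.IsInitialDatum Ω (fun x => c * φ x) ∧ ∀ x ∈ Ω, 0 < c * φ x := by
  have := isFiniteMeasure_restrict hΩb
  obtain ⟨f, hfs, hf, hf01⟩ := hΩ.exists_contDiff_support_eq (n := ⊤)
  have hf : ContDiff ℝ ∞ f := hf
  have hf0 : ∀ x, 0 ≤ f x := fun x => (hf01 (mem_range_self x)).1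
  have hf1 : ∀ x, f x ≤ 1 := fun x => (hf01 (mem_range_self x)).2
  have hfΩ : ∀ x, x ∈ Ω ↔ 0 < f x := fun x => by
    rw [← hfs, Function.mem_support, (hf0 x).lt_iff_ne']
  have hfc : HasCompactSupport f := by
    rw [HasCompactSupport, tsupport, hfs]; exact hΩb.isCompact_closure
  obtain ⟨D, hD⟩ := G.exists_norm_hGrad_le hf hfc
  have hD0 : 0 ≤ D := (norm_nonneg _).trans (hD 0)
  refine ⟨fun x => expNegInvGlue (f x), fun c hc => ?_⟩
  have hpos : ∀ x ∈ Ω, 0 < c * expNegInvGlue (f x) := fun x hx =>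
    mul_pos hc (expNegInvGlue.pos_of_pos ((hfΩ x).1 hx))
  obtain ⟨x₀, hx₀⟩ := hΩne
  -- Since E vanishes for r ≤ 0, the shifted functions E(f - 1/(n+1)) are supported in the compact
  -- set {f ≥ 1/(n+1)} inside Ω. They converge uniformly together with their gradients by uniform
  -- continuity of E and E'.
  set E : ℝ → ℝ := fun r => c * expNegInvGlue r with hE
  have hEs : ContDiff ℝ ∞ E := contDiff_const.mul expNegInvGlue.contDiff
  have hEd : ∀ r, HasDerivAt E (deriv E r) r := fun r =>
    (hEs.differentiable (by simp) r).hasDerivAt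
  have hEc : Continuous (deriv E) := hEs.continuous_deriv (by norm_cast)
  have hunif : ∀ h : ℝ → ℝ, Continuous h → ∀ ε > 0, ∀ᶠ n : ℕ in atTop, ∀ x,
      |h (f x - 1 / ((n : ℝ) + 1)) - h (f x)| ≤ ε := by
    intro h hh ε hε
    obtain ⟨δ, hδ, hu⟩ := Metric.uniformContinuousOn_iff.1
      ((isCompact_Icc (a := (-1 : ℝ)) (b := 1)).uniformContinuousOn_of_continuous hh.continuousOn) ε hε
    filter_upwards [eventually_one_div_add_one_lt hδ,
      eventually_one_div_add_one_lt one_pos] with n hn hn1 x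
    have hn0 : 0 < 1 / ((n : ℝ) + 1) := by positivity
    refine (hu (f x - 1 / ((n : ℝ) + 1)) ⟨by linarith [hf0 x], by linarith [hf1 x]⟩ (f x)
      ⟨by linarith [hf0 x], hf1 x⟩ ?_).le
    rw [Real.dist_eq, sub_sub_cancel_left, abs_neg, abs_of_pos hn0]
    exact hn
  have hgr : ∀ (b : ℝ) x, G.hGrad (fun y => E (f y - b)) x = deriv E (f x - b) • G.hGrad f x := by
    intro b x
    exact G.hGrad_comp (H := fun r => E (r - b)) (hf.differentiable (by simp) x)
      (HasDerivAt.comp_sub_const (f x) b (hEd (f x - b)))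
  obtain ⟨B, hB⟩ := (isCompact_Icc (a := (0 : ℝ)) (b := 1)).exists_bound_of_continuousOn
    hEs.continuous.continuousOn
  obtain ⟨B', hB'⟩ := (isCompact_Icc (a := (0 : ℝ)) (b := 1)).exists_bound_of_continuousOn
    hEc.continuousOn
  refine ⟨⟨⟨fun x => deriv E (f x) • G.hGrad f x, ?_, ?_,
    fun n x => E (f x - 1 / ((n : ℝ) + 1)), fun n => ⟨?_, ?_⟩, ?_, ?_⟩, ?_, ?_, ?_⟩, hpos⟩
  · exact memLp_top_of_bound (hEs.continuous.comp hf.continuous).aestronglyMeasurable B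
      (Eventually.of_forall fun x => hB _ ⟨hf0 x, hf1 x⟩)
  · refine memLp_top_of_bound ((hEc.comp hf.continuous).smul
      (G.continuous_hGrad hf)).aestronglyMeasurable (B' * D) (Eventually.of_forall fun x => ?_)
    rw [norm_smul]
    exact mul_le_mul (hB' _ ⟨hf0 x, hf1 x⟩) (hD x) (norm_nonneg _)
      ((norm_nonneg _).trans (hB' _ ⟨hf0 x, hf1 x⟩))
  · exact hEs.comp (hf.sub contDiff_const)
  · have hn0 : 0 < 1 / ((n : ℝ) + 1) := by positivity
    have hcl : IsClosed {x | 1 / ((n : ℝ) + 1) ≤ f x} := isClosed_le continuous_const hf.continuous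
    have hsub : {x | 1 / ((n : ℝ) + 1) ≤ f x} ⊆ Ω := fun x hx => (hfΩ x).2 (hn0.trans_le hx)
    have hts : tsupport (fun x => E (f x - 1 / ((n : ℝ) + 1))) ⊆ {x | 1 / ((n : ℝ) + 1) ≤ f x} := by
      refine closure_minimal (fun x hx => ?_) hcl
      by_contra h
      refine hx ?_
      have h : f x < 1 / ((n : ℝ) + 1) := not_le.1 h
      simp only [hE]
      rw [expNegInvGlue.zero_of_nonpos (by linarith), mul_zero]
    exact ⟨(Metric.isCompact_of_isClosed_isBounded hcl (hΩb.subset hsub)).of_isClosed_subset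
      (isClosed_tsupport _) hts, hts.trans hsub⟩
  · exact tendsto_eLpNorm_top_zero fun ε hε => hunif E hEs.continuous ε hε
  · refine tendsto_eLpNorm_top_zero fun ε hε => ?_
    filter_upwards [hunif (deriv E) hEc (ε / (D + 1)) (by positivity)] with n hn x
    rw [hgr, ← sub_smul, norm_smul]
    calc _ ≤ ε / (D + 1) * D := mul_le_mul (hn x) (hD x) (norm_nonneg _) (by positivity)
      _ ≤ ε / (D + 1) * (D + 1) := by gcongr; linarith
      _ = ε := by field_simp
  · exact (hEs.continuous.comp hf.continuous).continuousOn
  · exact fun x hx => (hpos x hx).le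
  · exact ⟨x₀, hx₀, (hpos x₀ hx₀).ne'⟩

/-- Data with a large weighted mean blow up. -/
lemma exists_blowsUp_of_large (hΩ : IsOpen Ω) (hΩb : Bornology.IsBounded Ω)
    {α γ p q s : ℝ} (hα : 0 < α) (hp : 1 < p) (hs : 0 < s) (hq : max s (max (p - 1) 1) < q)
    {U : Set (EuclideanSpace ℝ (Fin N))} (hU : IsOpen U) (hUΩ : U ⊆ Ω) (hUne : U.Nonempty) :
    ∃ ρ : EuclideanSpace ℝ (Fin N) → ℝ, Continuous ρ ∧ (∀ x, 0 ≤ ρ x) ∧ (∀ x, ρ x ≤ 1) ∧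
      tsupport ρ ⊆ U ∧ 0 < ∫ x in Ω, ρ x ∧ ∃ M₀ : ℝ, ∀ u₀ : EuclideanSpace ℝ (Fin N) → ℝ,
        M₀ ≤ ∫ x in Ω, multiplierPrim (u₀ x) * ρ x → G.BlowsUpInFiniteTime Ω α γ p q s u₀ := by
  have := isFiniteMeasure_restrict hΩb
  obtain ⟨x₀, hx₀⟩ := hUne
  obtain ⟨ψ, hψU, hψc, hψ, hψ01, hψx₀⟩ := exists_contDiff_tsupport_subset (n := ⊤) (hU.mem_nhds hx₀)
  have hψ : ContDiff ℝ ∞ ψ := hψ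
  have hψ0 : ∀ x, 0 ≤ ψ x := fun x => (hψ01 (mem_range_self x)).1
  have hψ1 : ∀ x, ψ x ≤ 1 := fun x => (hψ01 (mem_range_self x)).2
  obtain ⟨k, hk, hest⟩ := exists_multiplier_estimate (γ := γ) hα hp hs hq
  have h1q : 1 < q := (le_max_right _ _).trans_lt ((le_max_right _ _).trans_lt hq)
  have hκ : 1 < 2 * q - 1 := by linarith
  obtain ⟨D, hD⟩ := G.exists_norm_hGrad_le hψ hψc
  have hD0 : 0 ≤ D := (norm_nonneg _).trans (hD 0)
  -- The constant k D comes from ∇_H ψ^k = k ψ^(k-1) ∇_H ψ.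
  obtain ⟨c, C, hc, hC, hest⟩ := hest (k * D) (by positivity)
  set ρ : EuclideanSpace ℝ (Fin N) → ℝ := fun x => ψ x ^ k with hρ
  have hρcont : Continuous ρ := hψ.continuous.pow k
  have hρ0 : ∀ x, 0 ≤ ρ x := fun x => pow_nonneg (hψ0 x) k
  have hρ1 : ∀ x, ρ x ≤ 1 := fun x => pow_le_one₀ (hψ0 x) (hψ1 x)
  have hρts : tsupport ρ ⊆ tsupport ψ := closure_mono fun x hx h =>
    hx (by simp only [hρ]; rw [h, zero_pow (by omega)])
  have hρU : tsupport ρ ⊆ U := hρts.trans hψU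
  have hρΩ : tsupport ρ ⊆ Ω := hρU.trans hUΩ
  have hρc : HasCompactSupport ρ := hψc.of_isClosed_subset (isClosed_tsupport _) hρts
  have hgrad : ∀ x, ‖G.hGrad ρ x‖ ≤ k * D * ψ x ^ (k - 1) := fun x => by
    rw [hρ, G.hGrad_comp (H := fun r => r ^ k) (hψ.differentiable (by simp) x) (hasDerivAt_pow k _),
      norm_smul, Real.norm_eq_abs, abs_of_nonneg (mul_nonneg (Nat.cast_nonneg k) (pow_nonneg (hψ0 x) _))]
    calc _ ≤ (k * ψ x ^ (k - 1)) * D :=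
          mul_le_mul_of_nonneg_left (hD x) (mul_nonneg (Nat.cast_nonneg k) (pow_nonneg (hψ0 x) _))
      _ = _ := by ring
  have hρi : Integrable ρ (volume.restrict Ω) :=
    (hρcont.integrable_of_hasCompactSupport hρc).integrableOn
  have hm : 0 < ∫ x in Ω, ρ x := by
    rw [setIntegral_eq_integral_of_forall_compl_eq_zero fun x hx =>
      image_eq_zero_of_notMem_tsupport fun h => hx (hρΩ h)]
    refine hρcont.integral_pos_of_hasCompactSupport_nonneg_nonzero hρc hρ0 (x := x₀) ?_
    simp [hρ, hψx₀]
  set m : ℝ := ∫ x in Ω, ρ x with hmdef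
  -- The factor m^(1-κ) is Jensen's constant for a weight of mass m, and C |Ω| is the additive error
  -- integrated over Ω.
  obtain ⟨M₀, hM₀⟩ := exists_blowup_of_superlinear hκ
    (show 0 < c * m ^ (1 - (2 * q - 1)) by positivity) (C * volume.real Ω)
  refine ⟨ρ, hρcont, hρ0, hρ1, hρU, hm, M₀, fun u₀ hu₀ => ?_⟩
  obtain ⟨T₁, hT₁, f, hf, hode⟩ := hM₀ _ hu₀
  have key : ∀ T : ℝ, 0 < T → ∀ u, G.IsWeakSolution T Ω α γ p q s u₀ u →
      T ≤ T₁ ∧ ∀ t ∈ Ico 0 T, f t ≤ ∫ x in Ω, multiplierPrim (u t x) * ρ x := by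
    rintro T hT u ⟨g, w, hsub, hsup⟩
    have hu := hsup.1.2.1
    have hu0 := hsup.1.1
    set F : ℝ → ℝ := fun t => ∫ x in Ω, multiplierPrim (u t x) * ρ x with hF
    have hFc : ContinuousOn F (Ico 0 T) :=
      continuousOn_integral_comp_mul hΩ hu continuous_multiplierPrim hρcont hρc hρΩ
    have hΦκ : Continuous fun r => multiplierPrim r ^ (2 * q - 1) :=
      continuous_multiplierPrim.rpow_const fun _ => Or.inr (by linarith)
    have hPc : ContinuousOn (fun t => ∫ x in Ω, multiplierPrim (u t x) ^ (2 * q - 1) * ρ x)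
        (Ico 0 T) :=
      continuousOn_integral_comp_mul hΩ hu hΦκ hρcont hρc hρΩ
    have hslice : ∀ h : ℝ → ℝ, Continuous h → ∀ t ∈ Ico 0 T,
        Integrable (fun x => h (u t x) * ρ x) (volume.restrict Ω) := by
      intro h hh t ht
      have h1 : ContinuousOn (fun x => h (u t x) * ρ x) (closure Ω) :=
        (hh.comp_continuousOn (hu.comp (f := fun x => (t, x)) (by fun_prop)
          fun x hx => ⟨ht, hx⟩)).mul hρcont.continuousOn
      exact (h1.integrableOn_compact hΩb.isCompact_closure).mono_set subset_closure
    have hF0 : F 0 = ∫ x in Ω, multiplierPrim (u₀ x) * ρ x := by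
      refine setIntegral_congr_fun hΩ.measurableSet fun x hx => ?_
      rw [le_antisymm (hsub.2.1 x hx) (hsup.2.1 x hx)]
    have hjen : ∀ t ∈ Ico 0 T, c * m ^ (1 - (2 * q - 1)) * F t ^ (2 * q - 1) - C * volume.real Ω ≤
        ∫ x in Ω, (c * (multiplierPrim (u t x) ^ (2 * q - 1) * ρ x) - C) := by
      intro t ht
      rw [integral_sub ((hslice _ hΦκ t ht).const_mul c) (integrable_const C), integral_const_mul,
        setIntegral_const, smul_eq_mul, mul_assoc, mul_comm C]
      refine sub_le_sub_right (mul_le_mul_of_nonneg_left ?_ hc.le) _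
      refine rpow_integral_mul_le hκ.le (hslice _ continuous_multiplierPrim t ht) hρi
        (hslice _ hΦκ t ht) ?_ hρ0 hm
      filter_upwards [ae_restrict_mem hΩ.measurableSet] with x hx using
        multiplierPrim_nonneg (hu0 t ht x (subset_closure hx))
    have hGc : ContinuousOn (fun t => c * m ^ (1 - (2 * q - 1)) * F t ^ (2 * q - 1) -
        C * volume.real Ω) (Ico 0 T) :=
      (continuousOn_const.mul (hFc.rpow_const fun _ _ => Or.inr (by linarith))).sub continuousOn_const
    have hpos : ∀ a b, 0 < a → a ≤ b → b < T →
        ∫ t in a..b, (c * m ^ (1 - (2 * q - 1)) * F t ^ (2 * q - 1) - C * volume.real Ω) ≤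
          F b - F a := by
      intro a b ha hab hb
      rcases hab.eq_or_lt with rfl | hab'
      · simp
      have hIcc : Icc a b ⊆ Ico 0 T := fun t ht => ⟨ha.le.trans ht.1, ht.2.trans_lt hb⟩
      refine le_trans ?_ (hsup.integral_le_sub hΩ hΩb hp h1q hs hψ hψ0 hψ1 hρc hρΩ hgrad hest
        ⟨ha, hab'.trans hb⟩ ⟨ha.trans hab', hb⟩ hab')
      refine intervalIntegral.integral_mono_on hab ?_ ?_ fun t ht => hjen t (hIcc ht)
      · exact (hGc.mono (by rwa [uIcc_of_le hab])).intervalIntegrable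
      · refine ContinuousOn.intervalIntegrable ?_
        rw [uIcc_of_le hab]
        refine (((continuousOn_const (c := c)).mul (hPc.mono hIcc)).sub
          (continuousOn_const (c := volume.real Ω * C))).congr fun t ht => ?_
        rw [integral_sub ((hslice _ hΦκ t (hIcc ht)).const_mul c) (integrable_const C),
          integral_const_mul, setIntegral_const, smul_eq_mul]
        rfl
    -- The weak formulation controls only interior times; the case a = 0 follows by letting a
    -- decrease to 0, using continuity of F at 0.
    refine hode T hT F hFc hF0 fun a b ha hab hb => ?_
    rcases ha.eq_or_lt with rfl | ha
    swap
    · exact hpos a b ha hab hb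
    rcases hab.eq_or_lt with rfl | hb0
    · simp
    have hIcc : Icc 0 b ⊆ Ico 0 T := fun t ht => ⟨ht.1, ht.2.trans_lt hb⟩
    set h : ℝ → ℝ := fun t => c * m ^ (1 - (2 * q - 1)) * F t ^ (2 * q - 1) - C * volume.real Ω
      with hh
    have hi : IntervalIntegrable h volume 0 b :=
      (hGc.mono (by rwa [uIcc_of_le hab])).intervalIntegrable
    have hprim : ContinuousOn (fun t => ∫ r in (0 : ℝ)..t, h r) (Icc 0 b) := by
      have := intervalIntegral.continuousOn_primitive_interval' hi left_mem_uIcc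
      rwa [uIcc_of_le hab] at this
    have hnb : 𝓝[Ioo 0 b] (0 : ℝ) ≤ 𝓝[Icc 0 b] 0 := nhdsWithin_mono _ Ioo_subset_Icc_self
    have hne : (𝓝[Ioo 0 b] (0 : ℝ)).NeBot := left_nhdsWithin_Ioo_neBot hb0
    have l1 : Tendsto (fun a => (∫ r in (0 : ℝ)..b, h r) - ∫ r in (0 : ℝ)..a, h r) (𝓝[Ioo 0 b] 0)
        (𝓝 ((∫ r in (0 : ℝ)..b, h r) - ∫ r in (0 : ℝ)..0, h r)) :=
      tendsto_const_nhds.sub ((hprim 0 ⟨le_rfl, hab⟩).tendsto.mono_left hnb)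
    have l2 : Tendsto (fun a => F b - F a) (𝓝[Ioo 0 b] 0) (𝓝 (F b - F 0)) :=
      tendsto_const_nhds.sub (((hFc.mono hIcc) 0 ⟨le_rfl, hab⟩).tendsto.mono_left hnb)
    rw [intervalIntegral.integral_same, sub_zero] at l1
    refine le_of_tendsto_of_tendsto l1 l2 ?_
    filter_upwards [self_mem_nhdsWithin] with a ha
    have hia : IntervalIntegrable h volume 0 a := hi.mono_set (by
      rw [uIcc_of_le hab, uIcc_of_le ha.1.le]; exact Icc_subset_Icc_right ha.2.le)
    rw [intervalIntegral.integral_interval_sub_left hi hia]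
    exact hpos a b ha.1 ha.2.le hb
  -- If u < f/m - 1 throughout Ω, then Φ(u) ≤ u gives F ≤ f - m < f, a contradiction; the -1
  -- supplies the strict inequality.
  refine ⟨T₁, hT₁, ?_, fun t => f t / m - 1, ?_, ?_⟩
  · refine iSup₂_le fun T hT => ?_
    obtain ⟨hT0, u, hu⟩ := hT
    exact ENNReal.ofReal_le_ofReal (key T hT0 u hu).1
  · exact tendsto_atTop_add_const_right _ _ (hf.atTop_div_const hm)
  · intro T hT u hu t ht
    by_contra! hlt
    have hft := (key T hT u hu).2 t ht
    obtain ⟨g, w, -, hsup⟩ := hu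
    have hu0 := hsup.1.1
    have hle : ∫ x in Ω, multiplierPrim (u t x) * ρ x ≤ ∫ x in Ω, (f t / m - 1) * ρ x := by
      refine setIntegral_mono_on ?_ (hρi.const_mul _) hΩ.measurableSet fun x hx => ?_
      · have h1 : ContinuousOn (fun x => multiplierPrim (u t x) * ρ x) (closure Ω) :=
          (continuous_multiplierPrim.comp_continuousOn (hsup.1.2.1.comp (f := fun x => (t, x))
            (by fun_prop) fun x hx => ⟨ht, hx⟩)).mul hρcont.continuousOn
        exact (h1.integrableOn_compact hΩb.isCompact_closure).mono_set subset_closure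
      · exact mul_le_mul_of_nonneg_right ((multiplierPrim_le_self
          (hu0 t ht x (subset_closure hx))).trans (hlt x hx).le) (hρ0 x)
    rw [integral_const_mul, ← hmdef, sub_mul, div_mul_cancel₀ _ hm.ne', one_mul] at hle
    linarith

end StratifiedGroup

end

/-! ### Large multiples of a given datum -/

theorem mainTheorem6 {N : ℕ} (G : StratifiedGroup N)
    (Ω : Set (EuclideanSpace ℝ (Fin N))) (hΩ_open : IsOpen Ω)
    (hΩ_bdd : Bornology.IsBounded Ω) (hΩ_ne : Ω.Nonempty)
    (α γ p q s : ℝ) (hα : 0 < α) (hγ : γ < 0) (hp : 1 < p) (hs : 0 < s)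
    (hq : max s (max (p - 1) 1) < q) :
    (∃ u₀ : EuclideanSpace ℝ (Fin N) → ℝ, G.IsInitialDatum Ω u₀ ∧ (∀ x ∈ Ω, 0 < u₀ x) ∧
      G.BlowsUpInFiniteTime Ω α γ p q s u₀) ∧
    ∀ φ : EuclideanSpace ℝ (Fin N) → ℝ, G.IsInitialDatum Ω φ →
      ∃ c₀ : ℝ, 0 < c₀ ∧ ∀ c : ℝ, c₀ ≤ c →
        G.BlowsUpInFiniteTime Ω α γ p q s (fun x => c * φ x) := by
  have := StratifiedGroup.isFiniteMeasure_restrict hΩ_bdd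
  have main : ∀ φ : EuclideanSpace ℝ (Fin N) → ℝ, G.IsInitialDatum Ω φ →
      ∃ c₀ : ℝ, 0 < c₀ ∧ ∀ c : ℝ, c₀ ≤ c →
        G.BlowsUpInFiniteTime Ω α γ p q s (fun x => c * φ x) := by
    rintro φ ⟨⟨g, hφS⟩, hφc, hφ0, x₀, hx₀, hφx₀⟩
    have hpos : 0 < φ x₀ := (hφ0 x₀ hx₀).lt_of_ne' hφx₀
    set e : ℝ := φ x₀ / 2 with he
    have he0 : 0 < e := by positivity
    -- The weight is supported where φ > e, so on its support Φ(c φ) ≥ Φ(c e). The threshold M₀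
    -- depends on this weight but not on c.
    obtain ⟨ρ, hρ, hρ0, hρ1, hρU, hm, M₀, hM₀⟩ := G.exists_blowsUp_of_large (γ := γ) hΩ_open hΩ_bdd
      hα hp hs hq (U := Ω ∩ φ ⁻¹' Ioi e) (hφc.isOpen_inter_preimage hΩ_open isOpen_Ioi)
      inter_subset_left ⟨x₀, hx₀, show e < φ x₀ by linarith⟩
    obtain ⟨A, hA⟩ := (tendsto_multiplierPrim.eventually_ge_atTop (M₀ / ∫ x in Ω, ρ x)).exists_forall_of_atTop
    -- The bound c ≥ A / e gives Φ(c e) ≥ M₀ / ∫ ρ, which lifts the weighted mean of the datum above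
    -- M₀.
    refine ⟨max 1 (A / e), by positivity, fun c hc => hM₀ _ ?_⟩
    have hc1 : 1 ≤ c := (le_max_left _ _).trans hc
    have hcA : A ≤ c * e := (div_le_iff₀ he0).1 ((le_max_right _ _).trans hc)
    have hφi : Integrable φ (volume.restrict Ω) := hφS.1.integrable le_top
    have hint : Integrable (fun x => multiplierPrim (c * φ x) * ρ x) (volume.restrict Ω) := by
      refine (hφi.const_mul c).abs.mono' ((continuous_multiplierPrim.comp_aestronglyMeasurable
        (hφi.const_mul c).aestronglyMeasurable).mul hρ.aestronglyMeasurable) ?_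
      filter_upwards [ae_restrict_mem hΩ_open.measurableSet] with x hx
      have h1 : 0 ≤ c * φ x := mul_nonneg (by linarith) (hφ0 x hx)
      rw [norm_mul, Real.norm_eq_abs, Real.norm_eq_abs, abs_of_nonneg (hρ0 x),
        abs_of_nonneg (multiplierPrim_nonneg h1), abs_of_nonneg h1]
      calc _ ≤ c * φ x * 1 := mul_le_mul (multiplierPrim_le_self h1) (hρ1 x) (hρ0 x) h1
        _ = _ := mul_one _
    calc M₀ ≤ multiplierPrim (c * e) * ∫ x in Ω, ρ x := (div_le_iff₀ hm).1 (hA _ hcA)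
      _ = ∫ x in Ω, multiplierPrim (c * e) * ρ x := (integral_const_mul _ _).symm
      _ ≤ _ := by
        refine integral_mono_of_nonneg (Eventually.of_forall fun x =>
          mul_nonneg (multiplierPrim_nonneg (by positivity)) (hρ0 x)) hint
          (Eventually.of_forall fun x => ?_)
        by_cases hx : x ∈ tsupport ρ
        · have : e < φ x := (hρU hx).2
          exact mul_le_mul_of_nonneg_right (monotone_multiplierPrim (by gcongr)) (hρ0 x)
        · simp [image_eq_zero_of_notMem_tsupport hx]
  -- The first claim follows from the second: a large multiple of a positive datum is again an
  -- admissible positive datum.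
  refine ⟨?_, main⟩
  obtain ⟨φ, hφ⟩ := G.exists_isInitialDatum_pos hΩ_open hΩ_bdd hΩ_ne
  have h1 : G.IsInitialDatum Ω φ := by simpa using (hφ 1 one_pos).1
  obtain ⟨c₀, hc₀, hblow⟩ := main φ h1
  exact ⟨fun x => c₀ * φ x, (hφ c₀ hc₀).1, (hφ c₀ hc₀).2, hblow c₀ le_rfl⟩
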